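/- Let $n\ge 3$ and let $f\in\mathbb{R}[x,y]$ be a real binary form of degree $n$ (a homogeneous polynomial of degree $n$) without multiple roots in $\mathbb{P}^1(\mathbb{C})$, i.e. not divisible in $\mathbb{C}[x,y]$ by the square of a nonzero linear form. The real (Waring) rank of $f$ is the minimum number $r$ such that $$f=\lambda_1 l_1^n+\cdots+\lambda_r l_r^n$$ with $\lambda_i\in\mathbb{R}$ and linear forms $l_i=\alpha_i x+\beta_i y\in\mathbb{R}[x,y]$. Then $f$ has real rank $n$ if and only if $f$ has $n$ distinct real roots, i.e. vanishes at exactly $n$ points of the real projective line $\mathbb{P}^1(\mathbb{R})$. -/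

import Mathlib

open scoped LinearAlgebra.Projectivization

namespace BinaryForm

/-- The linear form `a x + b y` in the two variables `x = X 0`, `y = X 1`. -/
noncomputable def linearForm {K : Type*} [CommRing K] (a b : K) : MvPolynomial (Fin 2) K :=
  MvPolynomial.C a * MvPolynomial.X 0 + MvPolynomial.C b * MvPolynomial.X 1

/-- `f` is a sum of `r` terms `λᵢ lᵢⁿ`, with `λᵢ ∈ K` and linear forms `lᵢ = αᵢ x + βᵢ y` over
`K`. -/
def HasWaringDecomposition {K : Type*} [CommRing K] (n : ℕ) (f : MvPolynomial (Fin 2) K)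
    (r : ℕ) : Prop :=
  ∃ c α β : Fin r → K, f = ∑ i, MvPolynomial.C (c i) * linearForm (α i) (β i) ^ n

/-- The Waring rank over `K` of a binary form `f` of degree `n`: the least number `r` of terms in
a decomposition `f = λ₁ l₁ⁿ + ⋯ + λᵣ lᵣⁿ` (`⊤` if there is no decomposition at all). -/
noncomputable def waringRank {K : Type*} [CommRing K] (n : ℕ) (f : MvPolynomial (Fin 2) K) : ℕ∞ :=
  ⨅ (r : ℕ) (_ : HasWaringDecomposition n f r), (r : ℕ∞)

/-- The roots of a binary form over a field `K`: the points of the projective line over `K` at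
which it vanishes. -/
def roots {K : Type*} [Field K] (f : MvPolynomial (Fin 2) K) : Set (ℙ K (Fin 2 → K)) :=
  {p | MvPolynomial.eval p.rep f = 0}

/-- For a form, vanishing at a point of the projective line does not depend on the homogeneous
coordinates chosen. -/
theorem mk_mem_roots_iff {K : Type*} [Field K] {n : ℕ} {f : MvPolynomial (Fin 2) K}
    (hf : f.IsHomogeneous n) (v : Fin 2 → K) (hv : v ≠ 0) :
    Projectivization.mk K v hv ∈ roots f ↔ MvPolynomial.eval v f = 0 := by
  obtain ⟨a, ha⟩ := Projectivization.exists_smul_eq_mk_rep K v hv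
  have h : MvPolynomial.eval ((a : K) • v) f = (a : K) ^ n * MvPolynomial.eval v f := by
    rw [MvPolynomial.eval_eq', MvPolynomial.eval_eq', Finset.mul_sum]
    refine Finset.sum_congr rfl fun d hd => ?_
    have hd' : d 0 + d 1 = n := by
      have := hf (MvPolynomial.mem_support_iff.mp hd)
      simpa [Finsupp.weight_apply, Finsupp.sum_fintype, Fin.sum_univ_two] using this
    simp only [Fin.prod_univ_two, Pi.smul_apply, smul_eq_mul, ← hd']
    ring
  change MvPolynomial.eval (Projectivization.mk K v hv).rep f = 0 ↔ _
  rw [← ha, Units.smul_def, h]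
  simp

/-- The point `(a : b)` of the projective line over `K` is a multiple root of the binary form `f`:
the square of the linear form `b x - a y`, which vanishes exactly at `(a : b)`, divides `f`. -/
def IsMultipleRoot {K : Type*} [CommRing K] (f : MvPolynomial (Fin 2) K) (a b : K) : Prop :=
  linearForm b (-a) ^ 2 ∣ f

/-- The real binary form `f` has no multiple root on the complex projective line. (The zero form
has multiple roots in this sense.) -/
def NoMultipleComplexRoots (f : MvPolynomial (Fin 2) ℝ) : Prop :=
  ∀ a b : ℂ, (a, b) ≠ (0, 0) →
    ¬ IsMultipleRoot (MvPolynomial.map (algebraMap ℝ ℂ) f) a b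

end BinaryForm

/-!
Write `∂ᵥ f = v₀ f_x + v₁ f_y`. If `∂ᵥ f = ∑ cᵢ lᵢⁿ⁻¹` and no `lᵢ` is killed by `∂ᵥ`, integration
gives a decomposition of `f` with one more term, a multiple of `(v₁ x - v₀ y)ⁿ`
(`HasDecompositionAvoiding.of_dirDeriv`). Conversely `∂ᵥ` removes from a decomposition of `f` a term
whose linear form it kills. All rank statements are inductions on the degree along these lines.

*Forms with `n` real roots have rank `n`.* By Rolle's theorem on the projective line
(`le_encard_roots_dirDeriv`) the form `∂ᵥ f` has `n - 1` real roots for every `v`. Killing one term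
at a time, a decomposition of `f` with fewer than `n` terms leads to a linear form that is an empty
sum (`lt_of_hasWaringDecomposition`); integrating, `f` has a decomposition with `n` terms
(`hasDecompositionAvoiding_of_real_roots`).

*Other squarefree forms have rank less than `n`.* Such a form has a nonreal root. A cubic with a
nonreal root is a sum of two cubes (`exists_eq_sum_two_cubes`). In degree at least `4` it suffices
to find `v` such that `∂ᵥ f` is again squarefree with a nonreal root and can be integrated. All
conditions but the nonreal root exclude finitely many directions `v` only; they are controlled by
the Hessian determinant. The nonreal root is provided by `exists_dirDeriv_hasNonrealRoot`:

* At a root `z` of `f` in the upper half plane Euler's identity gives `f_x / f_y = -1 / z`, in the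
  upper half plane. If the Hessian determinant, which up to a positive factor is the Wronskian of
  `f_x (t, 1)` and `f_y (t, 1)`, is negative at a real point, `f_x / f_y` maps nearby points of the
  upper half plane to the lower one. As finitely many points do not separate the half plane,
  `f_x / f_y` is real at points outside any given finite set, and these are roots of forms `∂ᵥ f`.
* Otherwise `f` has no real root, since the Hessian determinant is negative at a simple one. Then
  `|f|` is convex on every line not through the origin, so that `∂ᵥ f` has at most one real root,
  and being squarefree of degree at least `2` it has a nonreal one.
-/

namespace BinaryForm

open MvPolynomial

/-! ### Directional derivatives and Euler's identity -/

section Field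

variable {K : Type*} [Field K]

/-- The derivative `v₀ ∂f/∂x + v₁ ∂f/∂y` of `f` in the direction `v`. -/
noncomputable def dirDeriv (v : Fin 2 → K) (f : MvPolynomial (Fin 2) K) :
    MvPolynomial (Fin 2) K :=
  C (v 0) * pderiv 0 f + C (v 1) * pderiv 1 f

/-- The linear form `v₁ x - v₀ y`, whose only zero on the projective line is `(v₀ : v₁)`. -/
noncomputable def pointForm (v : Fin 2 → K) : MvPolynomial (Fin 2) K :=
  linearForm (v 1) (-(v 0))

theorem isHomogeneous_linearForm (a b : K) : (linearForm a b).IsHomogeneous 1 :=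
  (isHomogeneous_C_mul_X a 0).add (isHomogeneous_C_mul_X b 1)

theorem isHomogeneous_dirDeriv {n : ℕ} {f : MvPolynomial (Fin 2) K} (hf : f.IsHomogeneous (n + 1))
    (v : Fin 2 → K) : (dirDeriv v f).IsHomogeneous n :=
  (hf.pderiv.C_mul _).add (hf.pderiv.C_mul _)

theorem pderiv_comm (f : MvPolynomial (Fin 2) K) (i j : Fin 2) :
    pderiv i (pderiv j f) = pderiv j (pderiv i f) := by
  have h : ⁅pderiv (R := K) i, pderiv (R := K) j⁆ = 0 :=
    derivation_ext fun k => by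
      classical
      simp [Derivation.commutator_apply, pderiv_X, Pi.single_apply, apply_ite]
  have := DFunLike.congr_fun h f
  rw [Derivation.commutator_apply] at this
  simpa [sub_eq_zero] using this

theorem dirDeriv_comm (u v : Fin 2 → K) (f : MvPolynomial (Fin 2) K) :
    dirDeriv u (dirDeriv v f) = dirDeriv v (dirDeriv u f) := by
  simp only [dirDeriv, map_add, pderiv_C_mul, pderiv_comm f 1 0]
  ring

theorem pderiv_dirDeriv (i : Fin 2) (v : Fin 2 → K) (f : MvPolynomial (Fin 2) K) :
    pderiv i (dirDeriv v f) = dirDeriv v (pderiv i f) := by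
  simp only [dirDeriv, map_add, pderiv_C_mul, pderiv_comm f i]

theorem dirDeriv_add (v : Fin 2 → K) (f g : MvPolynomial (Fin 2) K) :
    dirDeriv v (f + g) = dirDeriv v f + dirDeriv v g := by
  simp only [dirDeriv, map_add]; ring

theorem dirDeriv_sub (v : Fin 2 → K) (f g : MvPolynomial (Fin 2) K) :
    dirDeriv v (f - g) = dirDeriv v f - dirDeriv v g := by
  simp only [dirDeriv, map_sub]; ring

theorem dirDeriv_mul (v : Fin 2 → K) (f g : MvPolynomial (Fin 2) K) :
    dirDeriv v (f * g) = dirDeriv v f * g + f * dirDeriv v g := by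
  simp only [dirDeriv, pderiv_mul]; ring

theorem dirDeriv_sum {ι : Type*} (s : Finset ι) (v : Fin 2 → K)
    (f : ι → MvPolynomial (Fin 2) K) :
    dirDeriv v (∑ i ∈ s, f i) = ∑ i ∈ s, dirDeriv v (f i) := by
  simp only [dirDeriv, map_sum, Finset.mul_sum, Finset.sum_add_distrib]

theorem dirDeriv_linearForm (v : Fin 2 → K) (a b : K) :
    dirDeriv v (linearForm a b) = C (v 0 * a + v 1 * b) := by
  simp [dirDeriv, linearForm, pderiv_X]

theorem dirDeriv_pointForm (v w : Fin 2 → K) :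
    dirDeriv v (pointForm w) = C (v 0 * w 1 - v 1 * w 0) := by
  rw [pointForm, dirDeriv_linearForm]; ring_nf

theorem dirDeriv_C_mul_linearForm_pow (v : Fin 2 → K) (c a b : K) (n : ℕ) :
    dirDeriv v (C c * linearForm a b ^ (n + 1)) =
      C (c * (n + 1) * (v 0 * a + v 1 * b)) * linearForm a b ^ n := by
  have h := dirDeriv_linearForm v a b
  rw [dirDeriv] at h ⊢
  simp only [pderiv_C_mul, pderiv_pow, Nat.add_sub_cancel, C_mul, C_add, map_one, map_natCast,
    Nat.cast_add, Nat.cast_one] at h ⊢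
  linear_combination C c * (n + 1) * linearForm a b ^ n * h

variable {A : Type*} [CommRing A] [Algebra K A]

theorem aeval_dirDeriv (v : Fin 2 → K) (w : Fin 2 → A) (f : MvPolynomial (Fin 2) K) :
    aeval w (dirDeriv v f) = algebraMap K A (v 0) * aeval w (pderiv 0 f) +
      algebraMap K A (v 1) * aeval w (pderiv 1 f) := by
  simp [dirDeriv]

theorem aeval_pointForm (v : Fin 2 → K) (w : Fin 2 → A) :
    aeval w (pointForm v) = algebraMap K A (v 1) * w 0 - algebraMap K A (v 0) * w 1 := by
  simp [pointForm, linearForm, sub_eq_add_neg]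

theorem euler {n : ℕ} {f : MvPolynomial (Fin 2) K} (hf : f.IsHomogeneous n) (w : Fin 2 → A) :
    w 0 * aeval w (pderiv 0 f) + w 1 * aeval w (pderiv 1 f) = n * aeval w f := by
  simpa using congrArg (aeval w) hf.sum_X_mul_pderiv

theorem euler_dirDeriv {n : ℕ} {f : MvPolynomial (Fin 2) K} (hf : f.IsHomogeneous n)
    (v : Fin 2 → K) : eval v (dirDeriv v f) = n * eval v f := by
  simpa [dirDeriv, coe_aeval_eq_eval] using euler hf v

theorem aeval_smul_of_isHomogeneous {n : ℕ} {f : MvPolynomial (Fin 2) K}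
    (hf : f.IsHomogeneous n) (a : A) (w : Fin 2 → A) :
    aeval (a • w) f = a ^ n * aeval w f := by
  rw [aeval_def, aeval_def, eval₂_eq', eval₂_eq', Finset.mul_sum]
  refine Finset.sum_congr rfl fun d hd => ?_
  have hd' : d 0 + d 1 = n := by
    have := hf (mem_support_iff.mp hd)
    simpa [Finsupp.weight_apply, Finsupp.sum_fintype, Fin.sum_univ_two] using this
  simp only [Fin.prod_univ_two, Pi.smul_apply, smul_eq_mul, ← hd']
  ring

theorem eval_smul_of_isHomogeneous {n : ℕ} {f : MvPolynomial (Fin 2) K}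
    (hf : f.IsHomogeneous n) (a : K) (w : Fin 2 → K) :
    eval (a • w) f = a ^ n * eval w f := by
  simpa [coe_aeval_eq_eval] using aeval_smul_of_isHomogeneous hf a w

/-! ### Division by the linear form of a root -/

theorem pointForm_ne_zero {v : Fin 2 → K} (hv : v ≠ 0) : pointForm v ≠ 0 := by
  intro h
  apply hv
  have h0 := congrArg (eval ![1, 0]) h
  have h1 := congrArg (eval ![0, 1]) h
  simp [pointForm, linearForm] at h0 h1
  ext i; fin_cases i <;> simp [h0, h1]

/-- A homogeneous multiple of a linear form is a homogeneous form times it. -/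
theorem exists_isHomogeneous_of_pointForm_dvd {n : ℕ} {f : MvPolynomial (Fin 2) K}
    (hf : f.IsHomogeneous (n + 1)) {v : Fin 2 → K} (h : pointForm v ∣ f) :
    ∃ g : MvPolynomial (Fin 2) K, g.IsHomogeneous n ∧ f = pointForm v * g := by
  obtain ⟨g, rfl⟩ := h
  refine ⟨homogeneousComponent n g, homogeneousComponent_isHomogeneous n g, ?_⟩
  have hl : (pointForm v).IsHomogeneous 1 := isHomogeneous_linearForm _ _
  have h1 : homogeneousComponent (n + 1) (pointForm v * g) = pointForm v * g :=
    homogeneousComponent_eq_self hf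
  conv_lhs => rw [← h1]
  conv_lhs => rw [← sum_homogeneousComponent g, Finset.mul_sum, map_sum]
  have h2 : ∀ i ∈ Finset.range (g.totalDegree + 1),
      homogeneousComponent (n + 1) (pointForm v * homogeneousComponent i g) =
        if i = n then pointForm v * homogeneousComponent n g else 0 := by
    intro i _
    rw [homogeneousComponent_of_mem (m := n + 1) (n := 1 + i)
      (hl.mul (homogeneousComponent_isHomogeneous i g))]
    by_cases hi : i = n
    · subst hi; simp [add_comm]
    · rw [if_neg (by omega), if_neg hi]
  rw [Finset.sum_congr rfl h2, Finset.sum_ite_eq']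
  split_ifs with h3
  · rfl
  · rw [homogeneousComponent_eq_zero n g (by simpa using h3), mul_zero]

theorem pointForm_dvd_of_eval_eq_zero {n : ℕ} {f : MvPolynomial (Fin 2) K}
    (hf : f.IsHomogeneous n) {v : Fin 2 → K} (hv : v ≠ 0) (h : eval v f = 0) :
    pointForm v ∣ f := by
  obtain ⟨j, hj⟩ := Function.ne_iff.mp hv
  -- Modulo `v₁ x - v₀ y` one has `vⱼ X = Xⱼ v`, hence `vⱼⁿ f = f (vⱼ X) = f (Xⱼ v) = Xⱼⁿ f v = 0`.
  have key : ∀ g : MvPolynomial (Fin 2) K,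
      pointForm v ∣ aeval ((C (v j) : MvPolynomial (Fin 2) K) • (X : Fin 2 → _)) g -
        aeval ((X j : MvPolynomial (Fin 2) K) • fun i => (C (v i) : MvPolynomial (Fin 2) K)) g := by
    intro g
    have hX : ∀ i, pointForm v ∣ (C (v j) * X i - X j * C (v i) : MvPolynomial (Fin 2) K) := by
      intro i
      fin_cases i <;> fin_cases j <;> simp [pointForm, linearForm]
      · simp [mul_comm]
      · exact ⟨1, by ring⟩
      · exact ⟨-1, by ring⟩
      · simp [mul_comm]
    induction g using MvPolynomial.induction_on with
    | C a => simp
    | add p q hp hq =>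
      simp only [map_add]
      convert dvd_add hp hq using 1; ring
    | mul_X p i hp =>
      simp only [map_mul, aeval_X, Pi.smul_apply, smul_eq_mul]
      have := dvd_add (hp.mul_right (C (v j) * X i)) ((hX i).mul_left
        (aeval ((X j : MvPolynomial (Fin 2) K) • fun i => (C (v i) : MvPolynomial (Fin 2) K)) p))
      convert this using 1; ring
  have h1 := key f
  rw [aeval_smul_of_isHomogeneous hf, aeval_smul_of_isHomogeneous hf, aeval_X_left_apply] at h1
  have h2 : aeval (fun i => (C (v i) : MvPolynomial (Fin 2) K)) f = C (eval v f) := by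
    have := aeval_algebraMap_apply (MvPolynomial (Fin 2) K) v f
    rwa [aeval_eq_eval, algebraMap_eq] at this
  rw [h2, h, map_zero, mul_zero, sub_zero, ← map_pow] at h1
  exact ((isUnit_iff_ne_zero.mpr (pow_ne_zero n hj)).map C).dvd_mul_left.mp h1

theorem exists_eq_pointForm_mul {n : ℕ} {f : MvPolynomial (Fin 2) K}
    (hf : f.IsHomogeneous (n + 1)) {v : Fin 2 → K} (hv : v ≠ 0) (h : eval v f = 0) :
    ∃ g : MvPolynomial (Fin 2) K, g.IsHomogeneous n ∧ f = pointForm v * g :=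
  exists_isHomogeneous_of_pointForm_dvd hf (pointForm_dvd_of_eval_eq_zero hf hv h)

theorem eq_C_of_isHomogeneous_zero {f : MvPolynomial (Fin 2) K} (hf : f.IsHomogeneous 0) :
    ∃ c, f = C c :=
  ⟨_, (totalDegree_eq_zero_iff_eq_C.mp (Nat.le_zero.mp hf.totalDegree_le))⟩

theorem eq_linearForm_of_isHomogeneous_one {f : MvPolynomial (Fin 2) K} (hf : f.IsHomogeneous 1) :
    ∃ a b, f = linearForm a b := by
  obtain ⟨a, ha⟩ := eq_C_of_isHomogeneous_zero (hf.pderiv (i := 0))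
  obtain ⟨b, hb⟩ := eq_C_of_isHomogeneous_zero (hf.pderiv (i := 1))
  refine ⟨a, b, ?_⟩
  have h := hf.sum_X_mul_pderiv
  rw [Fin.sum_univ_two, ha, hb, one_smul] at h
  rw [← h, linearForm]; ring

/-- Two vectors on the same line through the origin are proportional. -/
theorem eq_smul_of_cross_eq_zero {u v : Fin 2 → K} (hu : u ≠ 0) (h : v 0 * u 1 = v 1 * u 0) :
    ∃ c : K, v = c • u := by
  by_cases h0 : u 0 = 0
  · have h1 : u 1 ≠ 0 := fun h1 => hu (by ext i; fin_cases i <;> simp [h0, h1])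
    refine ⟨v 1 / u 1, ?_⟩
    have : v 0 = 0 := by simpa [h0, h1] using h
    ext i; fin_cases i <;> simp [h0, this, h1]
  · refine ⟨v 0 / u 0, ?_⟩
    ext i; fin_cases i
    · simp [h0]
    · simp only [Fin.mk_one, Pi.smul_apply, smul_eq_mul]
      field_simp
      linear_combination -h

/-- A form killed by `∂ᵥ` is a multiple of a power of `v₁ x - v₀ y`. -/
theorem eq_C_mul_pointForm_pow_of_dirDeriv_eq_zero [CharZero K] {n : ℕ} :
    ∀ {f : MvPolynomial (Fin 2) K}, f.IsHomogeneous n → ∀ {v : Fin 2 → K}, v ≠ 0 →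
      dirDeriv v f = 0 → ∃ c, f = C c * pointForm v ^ n := by
  induction n with
  | zero =>
    intro f hf v hv h
    obtain ⟨c, hc⟩ := eq_C_of_isHomogeneous_zero hf
    exact ⟨c, by simpa using hc⟩
  | succ n ih =>
    intro f hf v hv h
    have h0 : eval v f = 0 := by
      have := euler_dirDeriv hf v
      rw [h, map_zero, eq_comm, mul_eq_zero] at this
      exact this.resolve_left (Nat.cast_ne_zero.mpr n.succ_ne_zero)
    obtain ⟨g, hg, rfl⟩ := exists_eq_pointForm_mul hf hv h0
    rw [dirDeriv_mul, dirDeriv_pointForm, mul_comm (v 0), sub_self, map_zero, zero_mul,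
      zero_add, mul_eq_zero] at h
    obtain ⟨c, rfl⟩ := ih hg hv (h.resolve_left (pointForm_ne_zero hv))
    exact ⟨c, by ring⟩

/-! ### Properties holding for finitely many directions only -/

/-- The property `P` holds for the vectors of finitely many lines through the origin at most. -/
def FinitelyManyDirections (P : (Fin 2 → K) → Prop) : Prop :=
  ∃ T : Set (Fin 2 → K), T.Finite ∧ ∀ v, v ≠ 0 → P v → ∃ t ∈ T, ∃ c : K, v = c • t

theorem FinitelyManyDirections.mono {P Q : (Fin 2 → K) → Prop} (hQ : FinitelyManyDirections Q)
    (h : ∀ v, v ≠ 0 → P v → Q v) : FinitelyManyDirections P := by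
  obtain ⟨T, hT, hTQ⟩ := hQ
  exact ⟨T, hT, fun v hv hP => hTQ v hv (h v hv hP)⟩

theorem FinitelyManyDirections.or {P Q : (Fin 2 → K) → Prop} (hP : FinitelyManyDirections P)
    (hQ : FinitelyManyDirections Q) : FinitelyManyDirections fun v => P v ∨ Q v := by
  obtain ⟨T, hT, hTP⟩ := hP
  obtain ⟨U, hU, hUQ⟩ := hQ
  refine ⟨T ∪ U, hT.union hU, ?_⟩
  rintro v hv (h | h)
  · obtain ⟨t, ht, htv⟩ := hTP v hv h
    exact ⟨t, Or.inl ht, htv⟩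
  · obtain ⟨t, ht, htv⟩ := hUQ v hv h
    exact ⟨t, Or.inr ht, htv⟩

theorem FinitelyManyDirections.exists_mem {ι : Type*} {S : Set ι} (hS : S.Finite)
    {P : ι → (Fin 2 → K) → Prop} (h : ∀ s ∈ S, FinitelyManyDirections (P s)) :
    FinitelyManyDirections fun v => ∃ s ∈ S, P s v := by
  choose! T hT hTP using h
  refine ⟨⋃ s ∈ S, T s, hS.biUnion hT, ?_⟩
  rintro v hv ⟨s, hs, hsv⟩
  obtain ⟨t, ht, htv⟩ := hTP s hs v hv hsv
  exact ⟨t, Set.mem_biUnion hs ht, htv⟩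

/-- A nonzero form vanishes at finitely many points of the projective line. -/
theorem finitelyManyDirections_eval_eq_zero {n : ℕ} :
    ∀ {f : MvPolynomial (Fin 2) K}, f.IsHomogeneous n → f ≠ 0 →
      FinitelyManyDirections fun v => eval v f = 0 := by
  induction n with
  | zero =>
    intro f hf h0
    obtain ⟨c, rfl⟩ := eq_C_of_isHomogeneous_zero hf
    refine ⟨∅, Set.finite_empty, fun v _ h => absurd ?_ h0⟩
    change eval v (C c) = 0 at h
    rw [eval_C] at h
    rw [h, map_zero]
  | succ n ih =>
    intro f hf h0
    by_cases hroot : ∃ t, t ≠ 0 ∧ eval t f = 0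
    · obtain ⟨t, ht, htf⟩ := hroot
      obtain ⟨g, hg, rfl⟩ := exists_eq_pointForm_mul hf ht htf
      obtain ⟨T, hT, hTg⟩ := ih hg (right_ne_zero_of_mul h0)
      refine ⟨insert t T, hT.insert t, fun v hv h => ?_⟩
      change eval v (pointForm t * g) = 0 at h
      rw [map_mul, mul_eq_zero] at h
      rcases h with h | h
      · refine ⟨t, Set.mem_insert _ _, eq_smul_of_cross_eq_zero ht ?_⟩
        simp [pointForm, linearForm] at h
        linear_combination h
      · obtain ⟨u, hu, huv⟩ := hTg v hv h
        exact ⟨u, Set.mem_insert_of_mem _ hu, huv⟩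
    · exact ⟨∅, Set.finite_empty, fun v hv h => absurd ⟨v, hv, h⟩ hroot⟩

theorem finitelyManyDirections_parallel {u : Fin 2 → K} (hu : u ≠ 0) :
    FinitelyManyDirections fun v => v 0 * u 1 = v 1 * u 0 :=
  ⟨{u}, Set.finite_singleton u, fun _ _ h => ⟨u, rfl, eq_smul_of_cross_eq_zero hu h⟩⟩

theorem FinitelyManyDirections.finite_affine {P : (Fin 2 → K) → Prop}
    (hP : FinitelyManyDirections P) : {z : K | P ![z, 1]}.Finite := by
  obtain ⟨T, hT, h⟩ := hP
  refine (hT.image fun t => t 0 / t 1).subset fun z hPz => ?_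
  have hz : (![z, 1] : Fin 2 → K) ≠ 0 := fun h => by simpa using congrFun h 1
  obtain ⟨t, ht, c, hc⟩ := h _ hz hPz
  have h0 : z = c * t 0 := by simpa using congrFun hc 0
  have h1 : 1 = c * t 1 := by simpa using congrFun hc 1
  refine ⟨t, ht, ?_⟩
  have : t 1 ≠ 0 := right_ne_zero_of_mul (h1 ▸ one_ne_zero)
  have hc : c = 1 / t 1 := by field_simp; exact h1.symm
  simp only [h0, hc]; ring

/-- Over an infinite field every property of finitely many directions fails somewhere. -/
theorem FinitelyManyDirections.exists_not [Infinite K] {P : (Fin 2 → K) → Prop}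
    (hP : FinitelyManyDirections P) : ∃ v, v ≠ 0 ∧ ¬ P v := by
  obtain ⟨z, hz⟩ := hP.finite_affine.exists_notMem
  exact ⟨![z, 1], fun h => by simpa using congrFun h 1, hz⟩

end Field

/-! ### Waring decompositions and integration -/

section Decomposition

variable {K : Type*} [Field K]

/-- `f = ∑ cᵢ (αᵢ x + βᵢ y)ⁿ` with `r` terms, where no derivative `∂ₛ` with `s ∈ S` kills any of the
linear forms `αᵢ x + βᵢ y`. -/
def HasDecompositionAvoiding (n : ℕ) (f : MvPolynomial (Fin 2) K) (r : ℕ)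
    (S : Set (Fin 2 → K)) : Prop :=
  ∃ c α β : Fin r → K, f = ∑ i, C (c i) * linearForm (α i) (β i) ^ n ∧
    ∀ s ∈ S, ∀ i, s 0 * α i + s 1 * β i ≠ 0

theorem HasDecompositionAvoiding.hasWaringDecomposition {n : ℕ} {f : MvPolynomial (Fin 2) K}
    {r : ℕ} {S : Set (Fin 2 → K)} (h : HasDecompositionAvoiding n f r S) :
    HasWaringDecomposition n f r :=
  let ⟨c, α, β, hf, _⟩ := h
  ⟨c, α, β, hf⟩

/-- A decomposition of `∂ᵥ f` whose linear forms are not killed by `∂ᵥ` integrates to a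
decomposition of `f` with one more term, the constant of integration `e (v₁ x - v₀ y)ⁿ⁺¹`. -/
theorem HasDecompositionAvoiding.of_dirDeriv [CharZero K] {n r : ℕ} {f : MvPolynomial (Fin 2) K}
    (hf : f.IsHomogeneous (n + 1)) {v : Fin 2 → K} (hv : v ≠ 0) {S : Set (Fin 2 → K)}
    (hS : ∀ s ∈ S, v 0 * s 1 ≠ v 1 * s 0)
    (h : HasDecompositionAvoiding n (dirDeriv v f) r (insert v S)) :
    HasDecompositionAvoiding (n + 1) f (r + 1) S := by
  obtain ⟨c, α, β, hsum, havoid⟩ := h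
  have hd : ∀ i, v 0 * α i + v 1 * β i ≠ 0 := havoid v (Set.mem_insert _ _)
  set c' : Fin r → K := fun i => c i / ((n + 1) * (v 0 * α i + v 1 * β i)) with hc'
  have hn : (n + 1 : K) ≠ 0 := by exact_mod_cast n.succ_ne_zero
  obtain ⟨e, he⟩ : ∃ e, f - ∑ i, C (c' i) * linearForm (α i) (β i) ^ (n + 1) =
      C e * pointForm v ^ (n + 1) := by
    refine eq_C_mul_pointForm_pow_of_dirDeriv_eq_zero ?_ hv ?_
    · refine hf.sub (IsHomogeneous.sum _ _ _ fun i _ => IsHomogeneous.C_mul ?_ _)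
      simpa using (isHomogeneous_linearForm (α i) (β i)).pow (n + 1)
    · rw [dirDeriv_sub, dirDeriv_sum, sub_eq_zero, hsum]
      refine Finset.sum_congr rfl fun i _ => ?_
      rw [dirDeriv_C_mul_linearForm_pow]
      congr 2
      have := hd i
      simp only [hc']
      field_simp
  refine ⟨Fin.cons e c', Fin.cons (v 1) α, Fin.cons (-(v 0)) β, ?_, ?_⟩
  · rw [Fin.sum_univ_succ]
    simp only [Fin.cons_zero, Fin.cons_succ]
    rw [← pointForm, ← he]; ring
  · intro s hs i
    refine Fin.cases ?_ (fun i => ?_) i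
    · simp only [Fin.cons_zero]
      intro h
      exact hS s hs (by linear_combination -h)
    · simpa using havoid s (Set.mem_insert_of_mem _ hs) i

end Decomposition

/-! ### Restriction to a line -/

/-- The polynomial `f (c + t v)` in `t`. -/
noncomputable def linePoly (c v : Fin 2 → ℝ) (f : MvPolynomial (Fin 2) ℝ) : Polynomial ℝ :=
  aeval (fun i => Polynomial.C (c i) + Polynomial.C (v i) * Polynomial.X) f

theorem aeval_linePoly {A : Type*} [CommRing A] [Algebra ℝ A] (c v : Fin 2 → ℝ)
    (f : MvPolynomial (Fin 2) ℝ) (z : A) :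
    Polynomial.aeval z (linePoly c v f) =
      aeval (fun i => algebraMap ℝ A (c i) + algebraMap ℝ A (v i) * z) f := by
  rw [linePoly, comp_aeval_apply]
  simp

theorem eval_linePoly (c v : Fin 2 → ℝ) (f : MvPolynomial (Fin 2) ℝ) (t : ℝ) :
    (linePoly c v f).eval t = eval (c + t • v) f := by
  have h := aeval_linePoly c v f t
  rw [Polynomial.coe_aeval_eq_eval, aeval_eq_eval] at h
  rw [h]
  congr 2
  ext i
  simp [mul_comm]

theorem derivative_linePoly (c v : Fin 2 → ℝ) (f : MvPolynomial (Fin 2) ℝ) :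
    (linePoly c v f).derivative = linePoly c v (dirDeriv v f) := by
  induction f using MvPolynomial.induction_on with
  | C a => simp [linePoly, dirDeriv]
  | add p q hp hq =>
    rw [dirDeriv_add]
    simp only [linePoly, map_add] at hp hq ⊢
    rw [hp, hq]
  | mul_X p i hp =>
    have hX : dirDeriv v (X i) = C (v i) := by
      fin_cases i <;> simp [dirDeriv, pderiv_X]
    rw [dirDeriv_mul, hX]
    simp only [linePoly, map_add, map_mul, aeval_X, Polynomial.derivative_mul] at hp ⊢
    rw [hp]
    simp

/-- The polynomial `f (t, 1)` in `t`. -/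
noncomputable def dehomogenize (f : MvPolynomial (Fin 2) ℝ) : Polynomial ℝ :=
  linePoly ![0, 1] ![1, 0] f

theorem aeval_dehomogenize {A : Type*} [CommRing A] [Algebra ℝ A] (f : MvPolynomial (Fin 2) ℝ)
    (z : A) : Polynomial.aeval z (dehomogenize f) = aeval ![z, 1] f := by
  rw [dehomogenize, aeval_linePoly]
  congr 2
  ext i; fin_cases i <;> simp

theorem derivative_dehomogenize (f : MvPolynomial (Fin 2) ℝ) :
    (dehomogenize f).derivative = dehomogenize (pderiv 0 f) := by
  rw [dehomogenize, derivative_linePoly]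
  simp [dirDeriv, dehomogenize]

theorem eq_zero_of_dehomogenize_eq_zero {n : ℕ} {f : MvPolynomial (Fin 2) ℝ}
    (hf : f.IsHomogeneous n) (h : dehomogenize f = 0) : f = 0 := by
  by_contra h0
  obtain ⟨t, ht⟩ := (finitelyManyDirections_eval_eq_zero hf h0).finite_affine.exists_notMem
  apply ht
  have := aeval_dehomogenize f t
  rw [h, map_zero, aeval_eq_eval] at this
  exact this.symm

/-! ### Rolle's theorem on the projective line -/

section Rolle

variable {v : Fin 2 → ℝ}

theorem sq_add_sq_ne_zero (hv : v ≠ 0) : v 0 ^ 2 + v 1 ^ 2 ≠ 0 := by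
  intro h
  apply hv
  have h0 : v 0 = 0 := by nlinarith [sq_nonneg (v 0), sq_nonneg (v 1)]
  have h1 : v 1 = 0 := by nlinarith [sq_nonneg (v 0), sq_nonneg (v 1)]
  ext i; fin_cases i <;> simp [h0, h1]

theorem normal_add_smul_ne_zero (hv : v ≠ 0) (t : ℝ) : ![-(v 1), v 0] + t • v ≠ 0 := by
  intro h
  have h0 := congrFun h 0
  have h1 := congrFun h 1
  simp at h0 h1
  exact sq_add_sq_ne_zero hv (by linear_combination v 0 * h1 - v 1 * h0)

/-- The parametrization of the projective line minus the point `v` by the affine line through a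
normal vector of `v` in direction `v`. -/
noncomputable def affineChart (hv : v ≠ 0) (t : ℝ) : ℙ ℝ (Fin 2 → ℝ) :=
  Projectivization.mk ℝ (![-(v 1), v 0] + t • v) (normal_add_smul_ne_zero hv t)

theorem affineChart_injective (hv : v ≠ 0) : Function.Injective (affineChart hv) := by
  intro s t h
  obtain ⟨a, ha⟩ := (Projectivization.mk_eq_mk_iff' ℝ _ _ _ _).mp h
  have h0 : a * (-(v 1) + t * v 0) = -(v 1) + s * v 0 := congrFun ha 0
  have h1 : a * (v 0 + t * v 1) = v 0 + s * v 1 := congrFun ha 1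
  have hN := sq_add_sq_ne_zero hv
  have ha1 : a = 1 := by
    refine mul_right_cancel₀ hN ?_
    linear_combination v 0 * h1 - v 1 * h0
  subst ha1
  refine mul_right_cancel₀ hN ?_
  linear_combination -v 0 * h0 - v 1 * h1

theorem affineChart_ne (hv : v ≠ 0) (t : ℝ) : affineChart hv t ≠ Projectivization.mk ℝ v hv := by
  intro h
  obtain ⟨a, ha⟩ := (Projectivization.mk_eq_mk_iff' ℝ _ _ _ _).mp h
  have h0 := congrFun ha 0
  have h1 := congrFun ha 1
  simp at h0 h1
  exact sq_add_sq_ne_zero hv (by linear_combination v 1 * h0 - v 0 * h1)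

theorem exists_affineChart_eq (hv : v ≠ 0) {p : ℙ ℝ (Fin 2 → ℝ)}
    (hp : p ≠ Projectivization.mk ℝ v hv) : ∃ t, affineChart hv t = p := by
  induction p using Projectivization.ind with
  | h w hw =>
  have hN := sq_add_sq_ne_zero hv
  have hcross : v 0 * w 1 - v 1 * w 0 ≠ 0 := by
    intro h
    obtain ⟨c, hc⟩ := eq_smul_of_cross_eq_zero hv (v := w) (by linear_combination -h)
    exact hp ((Projectivization.mk_eq_mk_iff' ℝ _ _ _ _).mpr ⟨c, hc.symm⟩)
  refine ⟨(v 0 * w 0 + v 1 * w 1) / (v 0 * w 1 - v 1 * w 0), ?_⟩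
  refine (Projectivization.mk_eq_mk_iff' ℝ _ _ _ _).mpr
    ⟨(v 0 ^ 2 + v 1 ^ 2) / (v 0 * w 1 - v 1 * w 0), ?_⟩
  ext i
  fin_cases i
  · change (v 0 ^ 2 + v 1 ^ 2) / (v 0 * w 1 - v 1 * w 0) * w 0 =
      -(v 1) + (v 0 * w 0 + v 1 * w 1) / (v 0 * w 1 - v 1 * w 0) * v 0
    field_simp
    ring
  · change (v 0 ^ 2 + v 1 ^ 2) / (v 0 * w 1 - v 1 * w 0) * w 1 =
      v 0 + (v 0 * w 0 + v 1 * w 1) / (v 0 * w 1 - v 1 * w 0) * v 1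
    field_simp
    ring

theorem affineChart_mem_roots_iff {n : ℕ} {f : MvPolynomial (Fin 2) ℝ} (hf : f.IsHomogeneous n)
    (hv : v ≠ 0) (t : ℝ) :
    affineChart hv t ∈ roots f ↔ (linePoly ![-(v 1), v 0] v f).eval t = 0 := by
  rw [affineChart, mk_mem_roots_iff hf, eval_linePoly]

/-- Differentiating a form in any direction loses at most one real root. -/
theorem le_encard_roots_dirDeriv {n : ℕ} (hn : 1 ≤ n) {f : MvPolynomial (Fin 2) ℝ}
    (hf : f.IsHomogeneous (n + 1)) (h0 : f ≠ 0)
    (hroots : ((n + 1 : ℕ) : ℕ∞) ≤ (roots f).encard) (hv : v ≠ 0) :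
    dirDeriv v f ≠ 0 ∧ (n : ℕ∞) ≤ (roots (dirDeriv v f)).encard := by
  classical
  set p := Projectivization.mk ℝ v hv with hp
  set h := linePoly ![-(v 1), v 0] v f with hh
  have hder : h.derivative = linePoly ![-(v 1), v 0] v (dirDeriv v f) := derivative_linePoly _ _ _
  have hf' := isHomogeneous_dirDeriv hf v
  have hne : h ≠ 0 := by
    intro hzero
    obtain ⟨w, hw, hnot⟩ := ((finitelyManyDirections_eval_eq_zero hf h0).or
      (finitelyManyDirections_parallel hv)).exists_not
    rw [not_or] at hnot
    have hwp : Projectivization.mk ℝ w hw ≠ p := by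
      intro heq
      obtain ⟨a, ha⟩ := (Projectivization.mk_eq_mk_iff' ℝ _ _ _ _).mp heq
      apply hnot.2
      rw [← ha]; simp; ring
    obtain ⟨t, ht⟩ := exists_affineChart_eq hv hwp
    apply hnot.1
    rw [← mk_mem_roots_iff hf w hw, ← ht, affineChart_mem_roots_iff hf, ← hh, hzero,
      Polynomial.eval_zero]
  have hset : roots f \ {p} = affineChart hv '' (h.roots.toFinset : Set ℝ) := by
    ext q
    constructor
    · rintro ⟨hq, hqp⟩
      obtain ⟨t, rfl⟩ := exists_affineChart_eq hv hqp
      refine ⟨t, ?_, rfl⟩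
      rw [affineChart_mem_roots_iff hf] at hq
      simpa [hne] using hq
    · rintro ⟨t, ht, rfl⟩
      refine ⟨(affineChart_mem_roots_iff hf hv t).mpr ?_, affineChart_ne hv t⟩
      simpa [hne] using ht
  have hcard : (roots f \ {p}).encard = h.roots.toFinset.card := by
    rw [hset, (affineChart_injective hv).encard_image, Set.encard_coe_eq_coe_finsetCard]
  have hsub : affineChart hv '' (h.derivative.roots.toFinset : Set ℝ) ⊆
      roots (dirDeriv v f) \ {p} := by
    rintro _ ⟨t, ht, rfl⟩
    refine ⟨(affineChart_mem_roots_iff hf' hv t).mpr ?_, affineChart_ne hv t⟩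
    rw [← hder]
    exact Polynomial.isRoot_of_mem_roots (by simpa using ht)
  have hcard' : (h.derivative.roots.toFinset.card : ℕ∞) ≤
      (roots (dirDeriv v f) \ {p}).encard := by
    rw [← Set.encard_coe_eq_coe_finsetCard, ← (affineChart_injective hv).encard_image]
    exact Set.encard_le_encard hsub
  have hrolle := Polynomial.card_roots_toFinset_le_derivative h
  have hcount : n + 1 ≤ h.roots.toFinset.card + (if p ∈ roots f then 1 else 0) := by
    split_ifs with hpf
    · rw [← Set.encard_sdiff_singleton_add_one hpf, hcard] at hroots
      exact_mod_cast hroots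
    · rw [Set.sdiff_singleton_eq_self hpf] at hcard
      rw [hcard] at hroots
      exact_mod_cast hroots
  constructor
  · intro hzero
    have hc : h.derivative = 0 := by rw [hder, hzero, linePoly, map_zero]
    rw [Polynomial.eq_C_of_derivative_eq_zero hc, Polynomial.roots_C] at hcount
    simp at hcount
    split_ifs at hcount <;> omega
  · by_cases hpf : p ∈ roots f
    · have hpf' : p ∈ roots (dirDeriv v f) := by
        rw [hp, mk_mem_roots_iff hf] at hpf
        rw [hp, mk_mem_roots_iff hf', euler_dirDeriv hf, hpf, mul_zero]
      rw [if_pos hpf] at hcount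
      rw [← Set.encard_sdiff_singleton_add_one hpf']
      refine le_trans ?_ (add_le_add_left hcard' 1)
      exact_mod_cast (by omega)
    · rw [if_neg hpf] at hcount
      refine le_trans ?_ (hcard'.trans (Set.encard_le_encard Set.sdiff_subset))
      exact_mod_cast (by omega)

end Rolle

/-! ### The rank of a form with only real roots -/

/-- A form of degree `n + 1` with `n + 1` real roots is not a sum of `n` powers: differentiating in
the direction that kills the last power removes one power and one root. -/
theorem lt_of_hasWaringDecomposition {n : ℕ} :
    ∀ {f : MvPolynomial (Fin 2) ℝ}, f.IsHomogeneous (n + 1) → f ≠ 0 →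
      ((n + 1 : ℕ) : ℕ∞) ≤ (roots f).encard → ∀ {r : ℕ}, HasWaringDecomposition (n + 1) f r →
        n < r := by
  induction n with
  | zero =>
    rintro f - h0 - r ⟨c, α, β, rfl⟩
    by_contra! hr
    obtain rfl := Nat.le_zero.mp hr
    simp at h0
  | succ n ih =>
    rintro f hf h0 hroots r ⟨c, α, β, hsum⟩
    cases r with
    | zero => simp [hsum] at h0
    | succ r =>
      obtain ⟨v, hv, hkill⟩ : ∃ v : Fin 2 → ℝ, v ≠ 0 ∧
          v 0 * α (Fin.last r) + v 1 * β (Fin.last r) = 0 := by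
        by_cases hα : α (Fin.last r) = 0
        · exact ⟨![1, 0], fun h => by simpa using congrFun h 0, by simp [hα]⟩
        · exact ⟨![β (Fin.last r), -α (Fin.last r)],
            fun h => hα (by simpa using congrFun h 1), by simp; ring⟩
      obtain ⟨h0', hroots'⟩ := le_encard_roots_dirDeriv (by omega) hf h0 hroots hv
      refine Nat.succ_lt_succ (ih (isHomogeneous_dirDeriv hf v) h0' hroots'
        ⟨fun i => c i.castSucc * ((n + 1 : ℕ) + 1) *
          (v 0 * α i.castSucc + v 1 * β i.castSucc), fun i => α i.castSucc,
          fun i => β i.castSucc, ?_⟩)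
      rw [hsum, dirDeriv_sum, Fin.sum_univ_castSucc]
      simp only [dirDeriv_C_mul_linearForm_pow, hkill, mul_zero, map_zero, zero_mul, add_zero]

/-- A form of degree `n + 2` with `n + 2` real roots is a sum of `n + 2` powers. -/
theorem hasDecompositionAvoiding_of_real_roots {n : ℕ} :
    ∀ {f : MvPolynomial (Fin 2) ℝ}, f.IsHomogeneous (n + 2) → f ≠ 0 →
      ((n + 2 : ℕ) : ℕ∞) ≤ (roots f).encard → ∀ {S : Set (Fin 2 → ℝ)}, S.Finite →
        (∀ s ∈ S, s ≠ 0) → HasDecompositionAvoiding (n + 2) f (n + 2) S := by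
  induction n with
  | zero =>
    intro f hf h0 hroots S hS hS0
    have hpar : FinitelyManyDirections fun v : Fin 2 → ℝ => ∃ s ∈ S, v 0 * s 1 = v 1 * s 0 :=
      FinitelyManyDirections.exists_mem hS fun s hs => finitelyManyDirections_parallel (hS0 s hs)
    have hlin : FinitelyManyDirections fun v : Fin 2 → ℝ =>
        ∃ s ∈ S, eval v (dirDeriv s f) = 0 :=
      FinitelyManyDirections.exists_mem hS fun s hs => finitelyManyDirections_eval_eq_zero
        (isHomogeneous_dirDeriv hf s)
        (le_encard_roots_dirDeriv le_rfl hf h0 hroots (hS0 s hs)).1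
    obtain ⟨v, hv, hnot⟩ := ((hpar.or hlin).or
      (finitelyManyDirections_eval_eq_zero hf h0)).exists_not
    push Not at hnot
    obtain ⟨⟨hv1, hv2⟩, hv3⟩ := hnot
    refine HasDecompositionAvoiding.of_dirDeriv hf hv hv1 ?_
    obtain ⟨a, b, hab⟩ := eq_linearForm_of_isHomogeneous_one (isHomogeneous_dirDeriv hf v)
    refine ⟨fun _ => 1, fun _ => a, fun _ => b, by simpa using hab, fun s hs _ => ?_⟩
    have hne : eval v (dirDeriv s f) ≠ 0 := by
      rcases hs with rfl | hs
      · rw [euler_dirDeriv hf]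
        exact mul_ne_zero (by norm_num) hv3
      · exact hv2 s hs
    rwa [← one_mul (eval v _), ← Nat.cast_one, ← euler_dirDeriv (isHomogeneous_dirDeriv hf s),
      dirDeriv_comm, hab, dirDeriv_linearForm, eval_C] at hne
  | succ n ih =>
    intro f hf h0 hroots S hS hS0
    obtain ⟨v, hv, hnot⟩ := (FinitelyManyDirections.exists_mem hS fun s hs =>
      finitelyManyDirections_parallel (hS0 s hs)).exists_not
    push Not at hnot
    obtain ⟨h0', hroots'⟩ := le_encard_roots_dirDeriv (by omega) hf h0 hroots hv
    refine HasDecompositionAvoiding.of_dirDeriv hf hv hnot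
      (ih (isHomogeneous_dirDeriv hf v) h0' hroots' (hS.insert v) ?_)
    rintro s (rfl | hs)
    exacts [hv, hS0 s hs]

/-! ### Forms without nonreal roots -/

/-- The form `f` has a root on the complex projective line which is not real. -/
def HasNonrealRoot (f : MvPolynomial (Fin 2) ℝ) : Prop :=
  ∃ z : ℂ, z.im ≠ 0 ∧ aeval ![z, 1] f = 0

theorem exists_real_root {n : ℕ} {f : MvPolynomial (Fin 2) ℝ} (hf : f.IsHomogeneous (n + 1))
    (h : ¬ HasNonrealRoot f) : ∃ v, v ≠ 0 ∧ eval v f = 0 := by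
  by_cases hd : (dehomogenize f).derivative = 0
  · rw [derivative_dehomogenize] at hd
    have h0 := eq_zero_of_dehomogenize_eq_zero hf.pderiv hd
    have hv : (![1, 0] : Fin 2 → ℝ) ≠ 0 := fun h => by simpa using congrFun h 0
    refine ⟨![1, 0], hv, ?_⟩
    obtain ⟨c, hc⟩ := eq_C_mul_pointForm_pow_of_dirDeriv_eq_zero hf hv (by simp [dirDeriv, h0])
    rw [hc]
    simp [pointForm, linearForm]
  · have hdeg : (dehomogenize f).degree ≠ 0 := by
      intro h
      rw [Polynomial.eq_C_of_degree_eq_zero h, Polynomial.derivative_C] at hd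
      exact hd rfl
    obtain ⟨z, hz⟩ := IsAlgClosed.exists_aeval_eq_zero ℂ _ hdeg
    rw [aeval_dehomogenize] at hz
    have him : z.im = 0 := by
      by_contra him
      exact h ⟨z, him, hz⟩
    refine ⟨![z.re, 1], fun h => by simpa using congrFun h 1, ?_⟩
    have hz' : (z.re : ℂ) = z := Complex.ext rfl (by simp [him])
    have := Polynomial.aeval_algebraMap_apply ℂ z.re (dehomogenize f)
    rw [aeval_dehomogenize, aeval_dehomogenize, Complex.coe_algebraMap, hz', hz, eq_comm,
      Complex.ofReal_eq_zero, aeval_eq_eval] at this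
    exact this

theorem encard_roots_of_not_hasNonrealRoot {n : ℕ} :
    ∀ {f : MvPolynomial (Fin 2) ℝ}, f.IsHomogeneous n → f ≠ 0 →
      (∀ v, v ≠ 0 → ¬ pointForm v ^ 2 ∣ f) → ¬ HasNonrealRoot f → (roots f).encard = n := by
  induction n with
  | zero =>
    intro f hf h0 _ _
    obtain ⟨c, rfl⟩ := eq_C_of_isHomogeneous_zero hf
    have hc : c ≠ 0 := by rintro rfl; simp at h0
    simp [roots, hc]
  | succ n ih =>
    intro f hf h0 hsq hreal
    obtain ⟨v, hv, hvf⟩ := exists_real_root hf hreal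
    obtain ⟨g, hg, rfl⟩ := exists_eq_pointForm_mul hf hv hvf
    have ih' := ih hg (right_ne_zero_of_mul h0)
      (fun w hw hdvd => hsq w hw (hdvd.mul_left _))
      (fun ⟨z, hz, hzg⟩ => hreal ⟨z, hz, by rw [map_mul, hzg, mul_zero]⟩)
    have hnot : Projectivization.mk ℝ v hv ∉ roots g := by
      rw [mk_mem_roots_iff hg]
      intro h
      apply hsq v hv
      rw [pow_two]
      exact mul_dvd_mul_left _ (pointForm_dvd_of_eval_eq_zero hg hv h)
    have hset : roots (pointForm v * g) = insert (Projectivization.mk ℝ v hv) (roots g) := by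
      ext p
      induction p using Projectivization.ind with
      | h w hw =>
      rw [Set.mem_insert_iff, mk_mem_roots_iff hf, mk_mem_roots_iff hg, map_mul, mul_eq_zero,
        Projectivization.mk_eq_mk_iff']
      refine or_congr_left ?_
      have hp : eval w (pointForm v) = v 1 * w 0 - v 0 * w 1 := by
        simpa [aeval_eq_eval] using aeval_pointForm v w
      rw [hp]
      constructor
      · intro h
        obtain ⟨c, hc⟩ := eq_smul_of_cross_eq_zero hv (v := w) (by linear_combination h)
        exact ⟨c, hc.symm⟩
      · rintro ⟨c, rfl⟩
        simp; ring
    rw [hset, Set.encard_insert_of_notMem hnot, ih']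
    push_cast; rfl

/-! ### Pencils of real polynomials on the upper half plane -/

section UpperHalfPlane

open Complex Filter Topology ComplexConjugate

/-- The parametrization `a + b i ↦ a + eᵇ i` of the upper half plane by the plane. -/
noncomputable def upperHalfPlaneChart (w : ℂ) : ℂ := ⟨w.re, Real.exp w.im⟩

theorem continuous_upperHalfPlaneChart : Continuous upperHalfPlaneChart := by
  have h : upperHalfPlaneChart = fun w => (w.re : ℂ) + (Real.exp w.im : ℂ) * I := by
    funext w
    apply Complex.ext <;> simp [upperHalfPlaneChart, -ofReal_exp]
  rw [h]
  fun_prop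

theorem upperHalfPlaneChart_injective : Function.Injective upperHalfPlaneChart := by
  intro w z h
  have h1 := congrArg re h
  have h2 := congrArg im h
  exact Complex.ext h1 (Real.exp_injective h2)

theorem exists_upperHalfPlaneChart_eq {z : ℂ} (hz : 0 < z.im) :
    ∃ w, upperHalfPlaneChart w = z :=
  ⟨⟨z.re, Real.log z.im⟩, Complex.ext rfl (Real.exp_log hz)⟩

/-- If the Wronskian of two real polynomials `P`, `Q` is negative at a real point, then `P / Q` maps
some point of the upper half plane to the lower half plane. -/
theorem exists_im_mul_conj_neg (P Q : Polynomial ℝ) {t : ℝ}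
    (ht : P.derivative.eval t * Q.eval t - P.eval t * Q.derivative.eval t < 0) :
    ∃ z : ℂ, 0 < z.im ∧
      (Polynomial.aeval z P * conj (Polynomial.aeval z Q)).im < 0 := by
  have hline : HasDerivAt (fun s : ℝ => (t : ℂ) + s * I) I 0 := by
    simpa using ((hasDerivAt_id (0 : ℝ)).ofReal_comp.mul_const I).const_add (t : ℂ)
  have hpoly : ∀ R : Polynomial ℝ, HasDerivAt
      (fun s : ℝ => Polynomial.aeval ((t : ℂ) + s * I) R) ((R.derivative.eval t : ℝ) * I) 0 := by
    intro R
    have h1 : HasDerivAt (fun z : ℂ => Polynomial.aeval z R) ((R.derivative.eval t : ℝ) : ℂ)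
        ((t : ℂ) + (0 : ℝ) * I) := by
      have := Polynomial.hasDerivAt_aeval R ((t : ℂ) + (0 : ℝ) * I)
      refine this.congr_deriv ?_
      simp only [ofReal_zero, zero_mul, add_zero]
      exact Polynomial.aeval_algebraMap_apply_eq_algebraMap_eval t R.derivative
    exact h1.comp (0 : ℝ) hline
  have hval : ∀ R : Polynomial ℝ, Polynomial.aeval ((t : ℂ) + (0 : ℝ) * I) R = R.eval t := by
    intro R
    simp only [ofReal_zero, zero_mul, add_zero]
    exact Polynomial.aeval_algebraMap_apply_eq_algebraMap_eval t R
  have hder : HasDerivAt (fun s : ℝ => (Polynomial.aeval ((t : ℂ) + s * I) P *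
      conj (Polynomial.aeval ((t : ℂ) + s * I) Q)).im)
      (P.derivative.eval t * Q.eval t - P.eval t * Q.derivative.eval t) 0 := by
    have h := imCLM.hasFDerivAt.comp_hasDerivAt (0 : ℝ) ((hpoly P).mul (hpoly Q).star)
    refine h.congr_deriv ?_
    simp only [hval]
    simp
    ring
  have hslope := hasDerivAt_iff_tendsto_slope.mp hder
  have hev := (hslope.mono_left (nhdsWithin_mono 0
    (show Set.Ioi (0 : ℝ) ⊆ {0}ᶜ from fun x hx => (Set.mem_Ioi.mp hx).ne'))).eventually
    (gt_mem_nhds ht)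
  obtain ⟨s, hs, hs0⟩ := (hev.and (self_mem_nhdsWithin (a := (0 : ℝ)) (s := Set.Ioi 0))).exists
  have hs0 : 0 < s := hs0
  refine ⟨(t : ℂ) + s * I, by simpa using hs0, ?_⟩
  rw [slope_def_field, sub_zero, div_neg_iff] at hs
  rcases hs with ⟨-, h⟩ | ⟨h, -⟩
  · exact absurd h hs0.le.not_gt
  · simp only [hval] at h
    simpa [← ofReal_mul] using h

/-- A real pencil `a P + b Q` with a point of the upper half plane where `P / Q` is in the upper
half plane, and a real point where the Wronskian is negative, has members with a root in the upper
half plane. Any finite set of such roots can be avoided, as it does not separate the half plane. -/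
theorem exists_im_mul_conj_eq_zero (P Q : Polynomial ℝ) {E : Set ℂ} (hE : E.Finite) {z : ℂ}
    (hz : 0 < z.im) (hpos : 0 < (Polynomial.aeval z P * conj (Polynomial.aeval z Q)).im) {t : ℝ}
    (ht : P.derivative.eval t * Q.eval t - P.eval t * Q.derivative.eval t < 0) :
    ∃ w : ℂ, 0 < w.im ∧ w ∉ E ∧
      (Polynomial.aeval w P * conj (Polynomial.aeval w Q)).im = 0 := by
  set F : ℂ → ℝ := fun w => (Polynomial.aeval (upperHalfPlaneChart w) P *
    conj (Polynomial.aeval (upperHalfPlaneChart w) Q)).im with hF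
  have hcont : Continuous F := by
    have hc := continuous_upperHalfPlaneChart
    have hP := (Polynomial.continuous_aeval (A := ℂ) P).comp hc
    have hQ := (Polynomial.continuous_aeval (A := ℂ) Q).comp hc
    exact continuous_im.comp (hP.mul (continuous_conj.comp hQ))
  have hcount : (upperHalfPlaneChart ⁻¹' E).Countable :=
    (hE.preimage upperHalfPlaneChart_injective.injOn).countable
  have hdense : Dense (upperHalfPlaneChart ⁻¹' E)ᶜ := hcount.dense_compl ℝ
  have hconn : IsPreconnected (upperHalfPlaneChart ⁻¹' E)ᶜ :=
    (hcount.isConnected_compl_of_one_lt_rank (by simp)).isPreconnected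
  obtain ⟨a, ha, haE⟩ : ∃ a, a ∈ {w | F w < 0} ∧ a ∈ (upperHalfPlaneChart ⁻¹' E)ᶜ := by
    obtain ⟨u, hu, hneg⟩ := exists_im_mul_conj_neg P Q ht
    obtain ⟨a, rfl⟩ := exists_upperHalfPlaneChart_eq hu
    exact hdense.inter_open_nonempty _ (isOpen_lt hcont continuous_const) ⟨a, hneg⟩
  obtain ⟨b, hb, hbE⟩ : ∃ b, b ∈ {w | 0 < F w} ∧ b ∈ (upperHalfPlaneChart ⁻¹' E)ᶜ := by
    obtain ⟨b, rfl⟩ := exists_upperHalfPlaneChart_eq hz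
    exact hdense.inter_open_nonempty _ (isOpen_lt continuous_const hcont) ⟨b, hpos⟩
  obtain ⟨c, hcE, hc⟩ := hconn.intermediate_value haE hbE hcont.continuousOn
    ⟨(show F a < 0 from ha).le, (show 0 < F b from hb).le⟩
  exact ⟨upperHalfPlaneChart c, Real.exp_pos _, hcE, hc⟩

end UpperHalfPlane

/-! ### Smooth forms and the Hessian determinant -/

/-- The Hessian determinant of a binary form. -/
noncomputable def hess (f : MvPolynomial (Fin 2) ℝ) : MvPolynomial (Fin 2) ℝ :=
  pderiv 0 (pderiv 0 f) * pderiv 1 (pderiv 1 f) - pderiv 0 (pderiv 1 f) ^ 2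

/-- The gradient of `f` has no zero on the complex projective line. -/
def IsSmooth (f : MvPolynomial (Fin 2) ℝ) : Prop :=
  ∀ w : Fin 2 → ℂ, aeval w (pderiv 0 f) = 0 → aeval w (pderiv 1 f) = 0 → w = 0

theorem eval_map_complex (w : Fin 2 → ℂ) (f : MvPolynomial (Fin 2) ℝ) :
    eval w (map (algebraMap ℝ ℂ) f) = aeval w f := by
  rw [aeval_def, eval_map]

theorem aeval_ofReal (w : Fin 2 → ℝ) (f : MvPolynomial (Fin 2) ℝ) :
    aeval (fun i => (w i : ℂ)) f = (eval w f : ℂ) :=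
  aeval_algebraMap_apply ℂ w f

theorem map_complex_ne_zero {f : MvPolynomial (Fin 2) ℝ} (hf : f ≠ 0) :
    map (algebraMap ℝ ℂ) f ≠ 0 := by
  rwa [Ne, map_eq_zero_iff _ (map_injective _ (algebraMap ℝ ℂ).injective)]

theorem NoMultipleComplexRoots.isSmooth {n : ℕ} {f : MvPolynomial (Fin 2) ℝ}
    (hf : f.IsHomogeneous (n + 2)) (h : NoMultipleComplexRoots f) : IsSmooth f := by
  intro w h0 h1
  by_contra hw
  have hF : (map (algebraMap ℝ ℂ) f).IsHomogeneous (n + 2) := hf.map _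
  have hroot : eval w (map (algebraMap ℝ ℂ) f) = 0 := by
    have := euler hf w
    rw [h0, h1, mul_zero, mul_zero, add_zero, eq_comm, mul_eq_zero] at this
    rw [eval_map_complex]
    exact this.resolve_left (by exact_mod_cast (n + 1).succ_ne_zero)
  obtain ⟨g, hg, hfg⟩ := exists_eq_pointForm_mul hF hw hroot
  have hpf : eval w (pointForm w) = 0 := by
    simp [pointForm, linearForm]; ring
  have hg0 : eval w g = 0 := by
    rw [← eval_map_complex, ← pderiv_map, hfg, pderiv_mul, map_add, map_mul, map_mul, hpf] at h0 h1
    by_contra hne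
    apply hw
    simp [pointForm, linearForm, pderiv_X, hne] at h0 h1
    ext i; fin_cases i <;> simp [h0, h1]
  refine h (w 0) (w 1) (fun h => hw ?_) ?_
  · obtain ⟨h0, h1⟩ := Prod.mk.inj h
    ext i; fin_cases i <;> simp [h0, h1]
  · change pointForm w ^ 2 ∣ _
    rw [hfg, pow_two]
    exact mul_dvd_mul_left _ (pointForm_dvd_of_eval_eq_zero hg hw hg0)

theorem IsSmooth.ne_zero {f : MvPolynomial (Fin 2) ℝ} (h : IsSmooth f) : f ≠ 0 := by
  rintro rfl
  simpa using congrFun (h ![1, 0] (by simp) (by simp)) 0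

theorem IsSmooth.not_sq_dvd {f : MvPolynomial (Fin 2) ℝ} (h : IsSmooth f) {v : Fin 2 → ℝ}
    (hv : v ≠ 0) : ¬ pointForm v ^ 2 ∣ f := by
  rintro ⟨g, rfl⟩
  have hpf : aeval (fun i => (v i : ℂ)) (pointForm v) = 0 := by
    rw [aeval_pointForm]
    simp; ring
  have hw := h (fun i => (v i : ℂ)) (by simp [hpf]) (by simp [hpf])
  apply hv
  ext i
  simpa using congrFun hw i

theorem IsSmooth.dirDeriv_ne_zero {n : ℕ} {f : MvPolynomial (Fin 2) ℝ}
    (hf : f.IsHomogeneous (n + 2)) (h : IsSmooth f) {v : Fin 2 → ℝ} (hv : v ≠ 0) :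
    dirDeriv v f ≠ 0 := by
  intro h0
  obtain ⟨c, hc⟩ := eq_C_mul_pointForm_pow_of_dirDeriv_eq_zero hf hv h0
  exact h.not_sq_dvd hv (hc ▸ (pow_dvd_pow _ (by omega)).mul_left _)

theorem IsSmooth.encard_roots {n : ℕ} {f : MvPolynomial (Fin 2) ℝ} (hf : f.IsHomogeneous n)
    (h : IsSmooth f) (hreal : ¬ HasNonrealRoot f) : (roots f).encard = n :=
  encard_roots_of_not_hasNonrealRoot hf h.ne_zero (fun _ hv => h.not_sq_dvd hv) hreal

section Euler

variable {A : Type*} [CommRing A] [Algebra ℝ A]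

theorem euler_pderiv_zero {n : ℕ} {f : MvPolynomial (Fin 2) ℝ} (hf : f.IsHomogeneous (n + 2))
    (w : Fin 2 → A) : w 0 * aeval w (pderiv 0 (pderiv 0 f)) +
      w 1 * aeval w (pderiv 0 (pderiv 1 f)) = (n + 1) * aeval w (pderiv 0 f) := by
  have h := euler (hf.pderiv (i := 0)) w
  rw [pderiv_comm f 1 0] at h
  rw [h]; push_cast [Nat.add_sub_cancel]; norm_num

theorem euler_pderiv_one {n : ℕ} {f : MvPolynomial (Fin 2) ℝ} (hf : f.IsHomogeneous (n + 2))
    (w : Fin 2 → A) : w 0 * aeval w (pderiv 0 (pderiv 1 f)) +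
      w 1 * aeval w (pderiv 1 (pderiv 1 f)) = (n + 1) * aeval w (pderiv 1 f) := by
  have h := euler (hf.pderiv (i := 1)) w
  rw [h]; push_cast; norm_num

theorem aeval_hess (w : Fin 2 → A) (f : MvPolynomial (Fin 2) ℝ) :
    aeval w (hess f) = aeval w (pderiv 0 (pderiv 0 f)) * aeval w (pderiv 1 (pderiv 1 f)) -
      aeval w (pderiv 0 (pderiv 1 f)) ^ 2 := by
  simp [hess]

/-- At a root of `f` the Hessian determinant is a negative multiple of the squares of the partial
derivatives. -/
theorem aeval_hess_of_root {n : ℕ} {f : MvPolynomial (Fin 2) ℝ} (hf : f.IsHomogeneous (n + 2))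
    {w : Fin 2 → A} (hw : aeval w f = 0) :
    w 1 ^ 2 * aeval w (hess f) = -((n + 1) * aeval w (pderiv 0 f)) ^ 2 ∧
      w 0 ^ 2 * aeval w (hess f) = -((n + 1) * aeval w (pderiv 1 f)) ^ 2 := by
  have h := euler hf w
  have h0 := euler_pderiv_zero hf w
  have h1 := euler_pderiv_one hf w
  rw [hw, mul_zero] at h
  rw [aeval_hess, ← h0, ← h1]
  have h' : w 0 * (w 0 * aeval w (pderiv 0 (pderiv 0 f)) +
      w 1 * aeval w (pderiv 0 (pderiv 1 f))) + w 1 * (w 0 * aeval w (pderiv 0 (pderiv 1 f)) +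
      w 1 * aeval w (pderiv 1 (pderiv 1 f))) = 0 := by
    rw [h0, h1]; linear_combination (n + 1 : A) * h
  constructor
  · linear_combination aeval w (pderiv 0 (pderiv 0 f)) * h'
  · linear_combination aeval w (pderiv 1 (pderiv 1 f)) * h'

end Euler

theorem isHomogeneous_hess {n : ℕ} {f : MvPolynomial (Fin 2) ℝ} (hf : f.IsHomogeneous (n + 2)) :
    (hess f).IsHomogeneous (n + n) := by
  have h : ∀ i j, (pderiv i (pderiv j f)).IsHomogeneous n := fun i j =>
    (hf.pderiv (i := j)).pderiv (i := i)
  refine ((h 0 0).mul (h 1 1)).sub ?_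
  rw [pow_two]
  exact (h 0 1).mul (h 0 1)

theorem IsSmooth.aeval_hess_ne_zero {n : ℕ} {f : MvPolynomial (Fin 2) ℝ}
    (hf : f.IsHomogeneous (n + 2)) (h : IsSmooth f) {w : Fin 2 → ℂ} (hw : w ≠ 0)
    (hroot : aeval w f = 0) : aeval w (hess f) ≠ 0 := by
  intro h0
  obtain ⟨h1, h2⟩ := aeval_hess_of_root hf hroot
  have hn : (n + 1 : ℂ) ≠ 0 := by exact_mod_cast n.succ_ne_zero
  rw [h0, mul_zero, eq_comm, neg_eq_zero, pow_eq_zero_iff two_ne_zero, mul_eq_zero] at h1 h2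
  exact hw (h w (h1.resolve_left hn) (h2.resolve_left hn))

theorem IsSmooth.eval_hess_neg {n : ℕ} {f : MvPolynomial (Fin 2) ℝ}
    (hf : f.IsHomogeneous (n + 2)) (h : IsSmooth f) {w : Fin 2 → ℝ} (hw : w ≠ 0)
    (hroot : eval w f = 0) : eval w (hess f) < 0 := by
  have hroot' : aeval w f = 0 := by rwa [aeval_eq_eval]
  obtain ⟨h1, h2⟩ := aeval_hess_of_root hf hroot'
  rw [aeval_eq_eval] at h1 h2
  have hne : eval w (hess f) ≠ 0 := by
    intro h0
    have := h.aeval_hess_ne_zero hf (w := fun i => (w i : ℂ))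
      (fun h => hw (by ext i; simpa using congrFun h i)) (by rw [aeval_ofReal, hroot]; simp)
    rw [aeval_ofReal, h0] at this
    simp at this
  refine lt_of_le_of_ne ?_ hne
  by_contra! hpos
  refine sq_add_sq_ne_zero hw ?_
  nlinarith [sq_nonneg ((n + 1 : ℝ) * eval w (pderiv 0 f)), sq_nonneg (w 0), sq_nonneg (w 1),
    sq_nonneg ((n + 1 : ℝ) * eval w (pderiv 1 f)), mul_nonneg (sq_nonneg (w 0)) hpos.le,
    mul_nonneg (sq_nonneg (w 1)) hpos.le]

/-- Where the Hessian determinant is nonnegative, `|f|` is convex in every direction. -/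
theorem mul_dirDeriv_dirDeriv_nonneg {n : ℕ} {f : MvPolynomial (Fin 2) ℝ}
    (hf : f.IsHomogeneous (n + 2)) {w : Fin 2 → ℝ}
    (hw : 0 ≤ eval w (hess f)) (v : Fin 2 → ℝ) :
    0 ≤ eval w f * eval w (dirDeriv v (dirDeriv v f)) := by
  have h := euler hf w
  have h1 := euler_pderiv_zero hf w
  have h2 := euler_pderiv_one hf w
  rw [← aeval_eq_eval] at hw
  rw [aeval_hess] at hw
  have hQ : eval w (dirDeriv v (dirDeriv v f)) = v 0 ^ 2 * aeval w (pderiv 0 (pderiv 0 f)) +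
      2 * v 0 * v 1 * aeval w (pderiv 0 (pderiv 1 f)) +
      v 1 ^ 2 * aeval w (pderiv 1 (pderiv 1 f)) := by
    simp only [dirDeriv, map_add, pderiv_C_mul, map_mul, eval_C, pderiv_comm f 1 0, aeval_eq_eval]
    ring
  rw [hQ]
  rw [← aeval_eq_eval]
  generalize aeval w (pderiv 0 (pderiv 0 f)) = a at *
  generalize aeval w (pderiv 0 (pderiv 1 f)) = b at *
  generalize aeval w (pderiv 1 (pderiv 1 f)) = c at *
  generalize aeval w (pderiv 0 f) = p at *
  generalize aeval w (pderiv 1 f) = q at *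
  generalize aeval w f = e at *
  have hN : (0 : ℝ) < (n + 1) * (n + 2) := by positivity
  have hQw : (n + 1) * (n + 2) * e = w 0 ^ 2 * a + 2 * w 0 * w 1 * b + w 1 ^ 2 * c := by
    push_cast at h
    linear_combination -(n + 1 : ℝ) * h - w 0 * h1 - w 1 * h2
  refine nonneg_of_mul_nonneg_right ?_ hN
  have : (n + 1) * (n + 2) * (e * (v 0 ^ 2 * a + 2 * v 0 * v 1 * b + v 1 ^ 2 * c)) =
      (w 0 * v 0 * a + (w 0 * v 1 + w 1 * v 0) * b + w 1 * v 1 * c) ^ 2 +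
      (a * c - b ^ 2) * (w 0 * v 1 - w 1 * v 0) ^ 2 := by
    linear_combination (v 0 ^ 2 * a + 2 * v 0 * v 1 * b + v 1 ^ 2 * c) * hQw
  rw [this]
  positivity

/-! ### Degenerate directions -/

/-- The derivatives of a smooth form in all but finitely many directions are smooth. -/
theorem finitelyManyDirections_not_isSmooth {n : ℕ} {f : MvPolynomial (Fin 2) ℝ}
    (hf : f.IsHomogeneous (n + 2)) (hsm : IsSmooth f) (hne : hess f ≠ 0) :
    FinitelyManyDirections fun v => ¬ IsSmooth (dirDeriv v f) := by
  obtain ⟨T, hT, hTf⟩ := finitelyManyDirections_eval_eq_zero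
    ((isHomogeneous_hess hf).map (algebraMap ℝ ℂ)) (map_complex_ne_zero hne)
  have hT0 : {t ∈ T | t ≠ 0}.Finite := hT.subset (Set.sep_subset _ _)
  have hval : ∀ (v : Fin 2 → ℝ) (w : Fin 2 → ℂ),
      aeval w (pderiv 0 (dirDeriv v f)) = (v 0 : ℂ) * aeval w (pderiv 0 (pderiv 0 f)) +
        (v 1 : ℂ) * aeval w (pderiv 0 (pderiv 1 f)) ∧
      aeval w (pderiv 1 (dirDeriv v f)) = (v 0 : ℂ) * aeval w (pderiv 0 (pderiv 1 f)) +
        (v 1 : ℂ) * aeval w (pderiv 1 (pderiv 1 f)) := by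
    intro v w
    rw [pderiv_dirDeriv, pderiv_dirDeriv, aeval_dirDeriv, aeval_dirDeriv, pderiv_comm f 1 0]
    exact ⟨rfl, rfl⟩
  have key : FinitelyManyDirections fun v : Fin 2 → ℝ => ∃ t ∈ {t ∈ T | t ≠ 0},
      aeval t (pderiv 0 (dirDeriv v f)) = 0 ∧ aeval t (pderiv 1 (dirDeriv v f)) = 0 := by
    refine FinitelyManyDirections.exists_mem hT0 ?_
    rintro t ⟨-, ht⟩
    by_cases hex : ∃ u : Fin 2 → ℝ, u ≠ 0 ∧ aeval t (pderiv 0 (dirDeriv u f)) = 0 ∧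
        aeval t (pderiv 1 (dirDeriv u f)) = 0
    · obtain ⟨u, hu, hu0, hu1⟩ := hex
      refine (finitelyManyDirections_parallel hu).mono fun v _ hv => ?_
      obtain ⟨hv0, hv1⟩ := hv
      rw [(hval u t).1] at hu0
      rw [(hval u t).2] at hu1
      rw [(hval v t).1] at hv0
      rw [(hval v t).2] at hv1
      by_contra hcross
      have hc : (v 0 * u 1 - v 1 * u 0 : ℂ) ≠ 0 := by
        intro h
        apply hcross
        have : ((v 0 * u 1 - v 1 * u 0 : ℝ) : ℂ) = 0 := by push_cast; exact h
        exact sub_eq_zero.mp (Complex.ofReal_eq_zero.mp this)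
      have ha : aeval t (pderiv 0 (pderiv 0 f)) = 0 := by
        refine (mul_eq_zero.mp ?_).resolve_left hc
        linear_combination u 1 * hv0 - v 1 * hu0
      have hb : aeval t (pderiv 0 (pderiv 1 f)) = 0 := by
        refine (mul_eq_zero.mp ?_).resolve_left hc
        linear_combination v 0 * hu0 - u 0 * hv0
      have hd : aeval t (pderiv 1 (pderiv 1 f)) = 0 := by
        refine (mul_eq_zero.mp ?_).resolve_left hc
        linear_combination v 0 * hu1 - u 0 * hv1
      have h0 := euler_pderiv_zero hf t
      have h1 := euler_pderiv_one hf t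
      have hn : (n + 1 : ℂ) ≠ 0 := by exact_mod_cast n.succ_ne_zero
      rw [ha, hb, mul_zero, mul_zero, add_zero, eq_comm, mul_eq_zero] at h0
      rw [hb, hd, mul_zero, mul_zero, add_zero, eq_comm, mul_eq_zero] at h1
      exact ht (hsm t (h0.resolve_left hn) (h1.resolve_left hn))
    · exact ⟨∅, Set.finite_empty, fun v hv h => absurd ⟨v, hv, h⟩ hex⟩
  refine key.mono fun v hv hnot => ?_
  simp only [IsSmooth, not_forall] at hnot
  obtain ⟨w, h0, h1, hw⟩ := hnot
  have hdet : eval w (map (algebraMap ℝ ℂ) (hess f)) = 0 := by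
    rw [eval_map_complex, aeval_hess]
    rw [(hval v w).1] at h0
    rw [(hval v w).2] at h1
    have h2 : (v 0 : ℂ) * (aeval w (pderiv 0 (pderiv 0 f)) * aeval w (pderiv 1 (pderiv 1 f)) -
        aeval w (pderiv 0 (pderiv 1 f)) ^ 2) = 0 := by
      linear_combination aeval w (pderiv 1 (pderiv 1 f)) * h0 -
        aeval w (pderiv 0 (pderiv 1 f)) * h1
    have h3 : (v 1 : ℂ) * (aeval w (pderiv 0 (pderiv 0 f)) * aeval w (pderiv 1 (pderiv 1 f)) -
        aeval w (pderiv 0 (pderiv 1 f)) ^ 2) = 0 := by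
      linear_combination aeval w (pderiv 0 (pderiv 0 f)) * h1 -
        aeval w (pderiv 0 (pderiv 1 f)) * h0
    by_contra hne
    apply hv
    have hv0 := (mul_eq_zero.mp h2).resolve_right hne
    have hv1 := (mul_eq_zero.mp h3).resolve_right hne
    ext i; fin_cases i
    · simpa using hv0
    · simpa using hv1
  obtain ⟨t, ht, k, rfl⟩ := hTf w hw hdet
  have hk : k ≠ 0 := by rintro rfl; simp at hw
  have ht0 : t ≠ 0 := by rintro rfl; simp at hw
  have hhom := isHomogeneous_dirDeriv hf v
  rw [aeval_smul_of_isHomogeneous hhom.pderiv, mul_eq_zero] at h0 h1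
  exact ⟨t, ⟨ht, ht0⟩, h0.resolve_left (pow_ne_zero _ hk), h1.resolve_left (pow_ne_zero _ hk)⟩

theorem eval_hess_dirDeriv_self {n : ℕ} {g : MvPolynomial (Fin 2) ℝ}
    (hg : g.IsHomogeneous (n + 3)) (w : Fin 2 → ℝ) :
    eval w (hess (dirDeriv w g)) = (n + 1) ^ 2 * eval w (hess g) := by
  have h : ∀ i j, eval w (pderiv i (pderiv j (dirDeriv w g))) =
      (n + 1) * eval w (pderiv i (pderiv j g)) := by
    intro i j
    have hij : (pderiv i (pderiv j g)).IsHomogeneous (n + 1) :=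
      (hg.pderiv (i := j)).pderiv (i := i)
    rw [pderiv_dirDeriv, pderiv_dirDeriv, euler_dirDeriv hij]
    push_cast; rfl
  simp only [hess, map_sub, map_mul, map_pow, h]
  ring

/-- If the Hessian determinant of `g` is nonzero, so are those of its derivatives in all but
finitely many directions: for fixed `w`, the value at `w` of the Hessian determinant of `∂ᵥ g` is a
quadratic form in `v`, whose value for `v = w` is a multiple of that of `g`. -/
theorem finitelyManyDirections_hess_dirDeriv_eq_zero {n : ℕ} {g : MvPolynomial (Fin 2) ℝ}
    (hg : g.IsHomogeneous (n + 3)) (hne : hess g ≠ 0) :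
    FinitelyManyDirections fun v => hess (dirDeriv v g) = 0 := by
  obtain ⟨w, -, hw⟩ := (finitelyManyDirections_eval_eq_zero
    (isHomogeneous_hess (n := n + 1) hg) hne).exists_not
  set L : Fin 2 → Fin 2 → MvPolynomial (Fin 2) ℝ := fun i j =>
    linearForm (eval w (pderiv i (pderiv j (pderiv 0 g))))
      (eval w (pderiv i (pderiv j (pderiv 1 g)))) with hL
  have hev : ∀ v, eval v (L 0 0 * L 1 1 - L 0 1 * L 0 1) = eval w (hess (dirDeriv v g)) := by
    intro v
    simp only [hL, hess, linearForm, dirDeriv, map_add, pderiv_C_mul, map_sub, map_mul, map_pow,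
      eval_C, eval_X]
    ring
  have hhom : ∀ i j, (L i j).IsHomogeneous 1 := fun i j => isHomogeneous_linearForm _ _
  refine (finitelyManyDirections_eval_eq_zero
    (((hhom 0 0).mul (hhom 1 1)).sub ((hhom 0 1).mul (hhom 0 1))) ?_).mono fun v _ hv => ?_
  · intro h
    have := hev w
    rw [h, map_zero, eval_hess_dirDeriv_self hg, eq_comm, mul_eq_zero] at this
    exact hw (this.resolve_left (by positivity))
  · rw [hev, hv, map_zero]

theorem finitelyManyDirections_hess_dirDeriv_dirDeriv_eq_zero {n : ℕ}
    {f : MvPolynomial (Fin 2) ℝ} (hf : f.IsHomogeneous (n + 4)) (hne : hess f ≠ 0) :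
    FinitelyManyDirections fun v => hess (dirDeriv v (dirDeriv v f)) = 0 := by
  refine (finitelyManyDirections_eval_eq_zero
    (isHomogeneous_hess (n := n + 2) hf) hne).mono fun v _ hv => ?_
  have h := eval_hess_dirDeriv_self (isHomogeneous_dirDeriv (n := n + 3) hf v) v
  rw [hv, map_zero, eval_hess_dirDeriv_self (n := n + 1) hf, eq_comm, mul_eq_zero,
    mul_eq_zero] at h
  have h1 : ((n : ℝ) + 1) ^ 2 ≠ 0 := by positivity
  have h2 : (((n + 1 : ℕ) : ℝ) + 1) ^ 2 ≠ 0 := by positivity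
  exact (h.resolve_left h1).resolve_left h2

/-! ### Derivatives with nonreal roots -/

theorem finite_setOf_aeval_dirDeriv {n : ℕ} {f : MvPolynomial (Fin 2) ℝ}
    (hf : f.IsHomogeneous (n + 2)) (hsm : IsSmooth f) {P : (Fin 2 → ℝ) → Prop}
    (hP : FinitelyManyDirections P) :
    {z : ℂ | ∃ v, v ≠ 0 ∧ P v ∧ aeval ![z, 1] (dirDeriv v f) = 0}.Finite := by
  obtain ⟨T, hT, hTP⟩ := hP
  have hfin : ∀ t ∈ {t ∈ T | t ≠ 0}, {z : ℂ | aeval ![z, 1] (dirDeriv t f) = 0}.Finite := by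
    rintro t ⟨-, ht⟩
    have := (finitelyManyDirections_eval_eq_zero
      ((isHomogeneous_dirDeriv (n := n + 1) hf t).map (algebraMap ℝ ℂ))
      (map_complex_ne_zero (hsm.dirDeriv_ne_zero hf ht))).finite_affine
    simpa only [eval_map_complex] using this
  refine ((hT.subset (Set.sep_subset _ fun t => t ≠ 0)).biUnion hfin).subset ?_
  rintro z ⟨v, hv, hPv, hz⟩
  obtain ⟨t, ht, c, rfl⟩ := hTP v hv hPv
  have hc : c ≠ 0 := by rintro rfl; simp at hv
  have ht0 : t ≠ 0 := by rintro rfl; simp at hv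
  refine Set.mem_biUnion ⟨ht, ht0⟩ ?_
  have h : (c : ℂ) * aeval ![z, 1] (dirDeriv t f) = 0 := by
    rw [← hz, aeval_dirDeriv, aeval_dirDeriv]
    simp; ring
  exact (mul_eq_zero.mp h).resolve_left (Complex.ofReal_ne_zero.mpr hc)

/-- If the Hessian determinant is negative at some real point, the map `f_x / f_y` reverses the
orientation of the real line there, while it sends a root `z` of `f` in the upper half plane to
`-1 / z`, again in the upper half plane. -/
theorem exists_dirDeriv_hasNonrealRoot_of_hess_neg {n : ℕ} {f : MvPolynomial (Fin 2) ℝ}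
    (hf : f.IsHomogeneous (n + 2)) (hsm : IsSmooth f) (hreal : HasNonrealRoot f)
    {P : (Fin 2 → ℝ) → Prop} (hP : FinitelyManyDirections P) {t : ℝ}
    (ht : eval ![t, 1] (hess f) < 0) :
    ∃ v, v ≠ 0 ∧ ¬ P v ∧ HasNonrealRoot (dirDeriv v f) := by
  obtain ⟨z, hz, hzf⟩ : ∃ z : ℂ, 0 < z.im ∧ aeval ![z, 1] f = 0 := by
    obtain ⟨z, hz, hzf⟩ := hreal
    rcases hz.lt_or_gt with h | h
    · refine ⟨(starRingEnd ℂ) z, by simpa using h, ?_⟩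
      rw [← aeval_dehomogenize, Polynomial.aeval_conj, aeval_dehomogenize, hzf, map_zero]
    · exact ⟨z, h, hzf⟩
  have hz1 : (![z, 1] : Fin 2 → ℂ) ≠ 0 := fun h => by simpa using congrFun h 1
  have hpos : 0 < (Polynomial.aeval z (dehomogenize (pderiv 0 f)) *
      (starRingEnd ℂ) (Polynomial.aeval z (dehomogenize (pderiv 1 f)))).im := by
    rw [aeval_dehomogenize, aeval_dehomogenize]
    have he := euler hf ![z, 1]
    rw [hzf, mul_zero] at he
    simp only [Matrix.cons_val_zero, Matrix.cons_val_one, one_mul] at he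
    have h1 : aeval ![z, 1] (pderiv 1 f) = -(z * aeval ![z, 1] (pderiv 0 f)) := by
      linear_combination he
    have h0 : aeval ![z, 1] (pderiv 0 f) ≠ 0 := fun h0 =>
      hz1 (hsm _ h0 (by rw [h1, h0, mul_zero, neg_zero]))
    rw [h1]
    generalize aeval ![z, 1] (pderiv 0 f) = p at h0 ⊢
    have hp := Complex.normSq_pos.mpr h0
    rw [Complex.normSq_apply] at hp
    simp only [map_neg, map_mul, Complex.mul_im, Complex.mul_re, Complex.neg_im, Complex.neg_re,
      Complex.conj_re, Complex.conj_im]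
    nlinarith [mul_pos hp hz]
  have hW : (dehomogenize (pderiv 0 f)).derivative.eval t * (dehomogenize (pderiv 1 f)).eval t -
      (dehomogenize (pderiv 0 f)).eval t * (dehomogenize (pderiv 1 f)).derivative.eval t < 0 := by
    have h0 := euler_pderiv_zero hf ![t, 1]
    have h1 := euler_pderiv_one hf ![t, 1]
    rw [← aeval_eq_eval, aeval_hess] at ht
    rw [derivative_dehomogenize, derivative_dehomogenize]
    simp only [← Polynomial.coe_aeval_eq_eval, aeval_dehomogenize]
    simp only [Matrix.cons_val_zero, Matrix.cons_val_one, one_mul] at h0 h1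
    have hn : (0 : ℝ) < n + 1 := by positivity
    refine (mul_neg_iff.mp (lt_of_eq_of_lt ?_ ht)).elim (fun h => h.2)
      fun h => absurd h.1 hn.not_gt
    linear_combination aeval ![t, 1] (pderiv 0 (pderiv 1 f)) * h0 -
      aeval ![t, 1] (pderiv 0 (pderiv 0 f)) * h1
  obtain ⟨w, hw, hwE, hzero⟩ := exists_im_mul_conj_eq_zero _ _
    (finite_setOf_aeval_dirDeriv hf hsm hP) hz hpos hW
  rw [aeval_dehomogenize, aeval_dehomogenize] at hzero
  obtain ⟨v, hv, hvw⟩ : ∃ v : Fin 2 → ℝ, v ≠ 0 ∧ aeval ![w, 1] (dirDeriv v f) = 0 := by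
    by_cases hq : aeval ![w, 1] (pderiv 1 f) = 0
    · exact ⟨![0, 1], fun h => by simpa using congrFun h 1, by simp [dirDeriv, hq]⟩
    · generalize hp : aeval ![w, 1] (pderiv 0 f) = p at *
      generalize hq' : aeval ![w, 1] (pderiv 1 f) = q at *
      refine ⟨![Complex.normSq q, -(p * (starRingEnd ℂ) q).re], fun h => hq ?_, ?_⟩
      · simpa using congrFun h 0
      · have hr : (((p * (starRingEnd ℂ) q).re : ℝ) : ℂ) = p * (starRingEnd ℂ) q :=
          Complex.ext rfl (by simp only [Complex.ofReal_im, hzero])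
        rw [aeval_dirDeriv, hp, hq']
        simp only [Matrix.cons_val_zero, Matrix.cons_val_one, Complex.coe_algebraMap,
          Complex.ofReal_neg, hr, Complex.normSq_eq_conj_mul_self]
        ring
  exact ⟨v, hv, fun hPv => hwE ⟨v, hv, hPv, hvw⟩, w, hw.ne', hvw⟩

/-- If the Hessian determinant is nowhere negative, `f` has no real root and `|f|` is convex on
lines not through the origin, so that a derivative of `f` has at most one real root. With `h` the
restriction of `f` to such a line in direction `v`, this appears as monotonicity of `h h'`. -/
theorem hasNonrealRoot_dirDeriv_of_hess_nonneg {n : ℕ} {f : MvPolynomial (Fin 2) ℝ}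
    (hf : f.IsHomogeneous (n + 3)) (hsm : IsSmooth f)
    (hhess : ∀ w, 0 ≤ eval w (hess f)) {v : Fin 2 → ℝ} (hv : v ≠ 0)
    (hsm' : IsSmooth (dirDeriv v f)) : HasNonrealRoot (dirDeriv v f) := by
  by_contra hreal
  have hg := isHomogeneous_dirDeriv (n := n + 2) hf v
  have hcard := hsm'.encard_roots hg hreal
  have hroot : ∀ w, w ≠ 0 → eval w f ≠ 0 := fun w hw h =>
    (hsm.eval_hess_neg hf hw h).not_ge (hhess w)
  have hvg : Projectivization.mk ℝ v hv ∉ roots (dirDeriv v f) := by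
    rw [mk_mem_roots_iff hg, euler_dirDeriv hf]
    exact mul_ne_zero (by positivity) (hroot v hv)
  obtain ⟨p, q, hp, hq, hpq⟩ : ∃ p q, p ∈ roots (dirDeriv v f) ∧ q ∈ roots (dirDeriv v f) ∧
      p ≠ q := by
    have h1 : 1 < (roots (dirDeriv v f)).encard := by
      rw [hcard]; exact_mod_cast (by omega : 1 < n + 2)
    obtain ⟨p, q, hp, hq, h⟩ := Set.one_lt_encard_iff.mp h1
    exact ⟨p, q, hp, hq, h⟩
  obtain ⟨s, rfl⟩ := exists_affineChart_eq hv (fun h => hvg (h ▸ hp))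
  obtain ⟨t, rfl⟩ := exists_affineChart_eq hv (fun h => hvg (h ▸ hq))
  have hst : s ≠ t := fun h => hpq (h ▸ rfl)
  wlog hlt : s < t generalizing s t
  · exact this t hq s hp hpq.symm hst.symm (lt_of_le_of_ne (not_lt.mp hlt) hst.symm)
  set h := linePoly ![-(v 1), v 0] v f with hh
  have hder : h.derivative = linePoly ![-(v 1), v 0] v (dirDeriv v f) := derivative_linePoly _ _ _
  have hder2 : h.derivative.derivative =
      linePoly ![-(v 1), v 0] v (dirDeriv v (dirDeriv v f)) := by
    rw [hder, derivative_linePoly]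
  have hne : ∀ x, h.eval x ≠ 0 := fun x => by
    rw [hh, eval_linePoly]
    exact hroot _ (normal_add_smul_ne_zero hv x)
  have hmono : Monotone fun x => (h * h.derivative).eval x := by
    refine monotone_of_deriv_nonneg (h * h.derivative).differentiable fun x => ?_
    rw [Polynomial.deriv, Polynomial.derivative_mul, Polynomial.eval_add, Polynomial.eval_mul,
      Polynomial.eval_mul]
    have h2 : 0 ≤ h.eval x * h.derivative.derivative.eval x := by
      rw [hder2, hh, eval_linePoly, eval_linePoly]
      exact mul_dirDeriv_dirDeriv_nonneg hf (hhess _) v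
    nlinarith [mul_self_nonneg (h.derivative.eval x)]
  rw [affineChart_mem_roots_iff hg, ← hder] at hp hq
  have hsub : affineChart hv '' Set.Icc s t ⊆ roots (dirDeriv v f) := by
    rintro _ ⟨x, ⟨hx1, hx2⟩, rfl⟩
    rw [affineChart_mem_roots_iff hg, ← hder]
    have h1 := hmono hx1
    have h2 := hmono hx2
    simp only [Polynomial.eval_mul, hp, hq, mul_zero] at h1 h2
    exact (mul_eq_zero.mp (le_antisymm h2 h1)).resolve_left (hne x)
  have hfin : (roots (dirDeriv v f)).Finite := Set.finite_of_encard_eq_coe hcard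
  exact ((Set.Icc_infinite hlt).image (affineChart_injective hv).injOn) (hfin.subset hsub)

/-- If a smooth form of degree at least `3` has a nonreal root, so has some derivative `∂ᵥ f`, where
`v` can be kept off any finite set `P` of directions that contains those with `∂ᵥ f` not smooth. -/
theorem exists_dirDeriv_hasNonrealRoot {n : ℕ} {f : MvPolynomial (Fin 2) ℝ}
    (hf : f.IsHomogeneous (n + 3)) (hsm : IsSmooth f) (hreal : HasNonrealRoot f)
    {P : (Fin 2 → ℝ) → Prop} (hP : FinitelyManyDirections P)
    (hPsm : ∀ v, ¬ IsSmooth (dirDeriv v f) → P v) :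
    ∃ v, v ≠ 0 ∧ ¬ P v ∧ HasNonrealRoot (dirDeriv v f) := by
  by_cases hneg : ∃ t, eval ![t, 1] (hess f) < 0
  · obtain ⟨t, ht⟩ := hneg
    exact exists_dirDeriv_hasNonrealRoot_of_hess_neg (n := n + 1) hf hsm hreal hP ht
  · push Not at hneg
    have haff : ∀ w : Fin 2 → ℝ, w 1 ≠ 0 → 0 ≤ eval w (hess f) := by
      intro w hw
      have h : w = w 1 • ![w 0 / w 1, 1] := by
        ext i; fin_cases i <;> simp [hw, mul_div_cancel₀]
      rw [h, eval_smul_of_isHomogeneous (isHomogeneous_hess (n := n + 1) hf), pow_add]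
      exact mul_nonneg (mul_self_nonneg _) (hneg _)
    have hall : ∀ w : Fin 2 → ℝ, 0 ≤ eval w (hess f) := by
      intro w
      by_cases hw : w 1 = 0
      · have hlim := ((linePoly w ![0, 1] (hess f)).continuous.tendsto 0).mono_left
          (nhdsWithin_le_nhds (s := {0}ᶜ))
        simp only [eval_linePoly, zero_smul, add_zero] at hlim
        refine ge_of_tendsto hlim (Filter.eventually_of_mem self_mem_nhdsWithin fun x hx => ?_)
        exact haff _ (by simpa [hw] using hx)
      · exact haff w hw
    obtain ⟨v, hv, hPv⟩ := hP.exists_not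
    exact ⟨v, hv, hPv, hasNonrealRoot_dirDeriv_of_hess_nonneg hf hsm hall hv
      (not_not.mp fun h => hPv (hPsm v h))⟩

/-! ### Cubics with a nonreal root -/

theorem exists_cubic_coefficients {f : MvPolynomial (Fin 2) ℝ} (hf : f.IsHomogeneous 3) :
    ∃ a b c d : ℝ, f = C a * X 0 ^ 3 + C b * (X 0 ^ 2 * X 1) + C c * (X 0 * X 1 ^ 2) +
      C d * X 1 ^ 3 := by
  have hv : (![0, 1] : Fin 2 → ℝ) ≠ 0 := fun h => by simpa using congrFun h 1
  have hX : pointForm (![0, 1] : Fin 2 → ℝ) = X 0 := by simp [pointForm, linearForm]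
  have key : ∀ {m : ℕ} {g : MvPolynomial (Fin 2) ℝ}, g.IsHomogeneous (m + 1) →
      ∃ (k : MvPolynomial (Fin 2) ℝ) (d : ℝ), k.IsHomogeneous m ∧
        g = X 0 * k + C d * X 1 ^ (m + 1) := by
    intro m g hg
    obtain ⟨k, hk, h⟩ := exists_eq_pointForm_mul
      (hg.sub (isHomogeneous_C_mul_X_pow (eval ![0, 1] g) 1 (m + 1))) hv (by simp)
    exact ⟨k, _, hk, by rw [hX] at h; rw [← h]; ring⟩
  obtain ⟨g, d, hg, rfl⟩ := key hf
  obtain ⟨k, c, hk, rfl⟩ := key hg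
  obtain ⟨a, b, rfl⟩ := eq_linearForm_of_isHomogeneous_one hk
  exact ⟨a, b, c, d, by rw [linearForm]; ring⟩

/-- A cubic with a nonreal root is `l (X² + Y²)` for linear forms `X`, `Y`, `l = γ X + δ Y`. With
`m = -δ X + γ Y` it is a multiple of `l (l² + m²)`, which is half the sum of the cubes of
`l ± m / √3`. -/
theorem exists_eq_sum_two_cubes {f : MvPolynomial (Fin 2) ℝ} (hf : f.IsHomogeneous 3)
    (h0 : f ≠ 0) (hreal : HasNonrealRoot f) : HasWaringDecomposition 3 f 2 := by
  obtain ⟨A, B, C', D, rfl⟩ := exists_cubic_coefficients hf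
  obtain ⟨z, hz, hzf⟩ := hreal
  simp at hzf
  set a := z.re with ha
  set b := z.im with hb
  have hq : z ^ 2 - 2 * a * z + (a ^ 2 + b ^ 2) = 0 := by
    apply Complex.ext <;> simp [pow_two, ← ha, ← hb] <;> ring
  -- Division of the cubic by the quadratic form with roots `z` and its conjugate.
  have hrem : ((C' - A * (a ^ 2 + b ^ 2) + 2 * a * (B + 2 * a * A) : ℝ) : ℂ) * z +
      ((D - (B + 2 * a * A) * (a ^ 2 + b ^ 2) : ℝ) : ℂ) = 0 := by
    push_cast
    linear_combination hzf - (A * z + (B + 2 * a * A)) * hq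
  have hC : C' - A * (a ^ 2 + b ^ 2) + 2 * a * (B + 2 * a * A) = 0 := by
    have h := congrArg Complex.im hrem
    rw [Complex.add_im, Complex.im_ofReal_mul, Complex.ofReal_im, add_zero, Complex.zero_im,
      mul_eq_zero] at h
    exact h.resolve_right hz
  have hD : D - (B + 2 * a * A) * (a ^ 2 + b ^ 2) = 0 := by
    rw [hC, Complex.ofReal_zero, zero_mul, zero_add] at hrem
    exact Complex.ofReal_eq_zero.mp hrem
  -- In the coordinates `X = x - a y` and `Y = b y` the factor `A x + (B + 2 a A) y` is `A X + δ Y`.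
  obtain ⟨δ, hδ⟩ : ∃ δ, δ * b = a * A + (B + 2 * a * A) :=
    ⟨(a * A + (B + 2 * a * A)) / b, div_mul_cancel₀ _ hz⟩
  have hN : A ^ 2 + δ ^ 2 ≠ 0 := by
    intro hN
    have hA : A = 0 := by nlinarith [sq_nonneg A, sq_nonneg δ]
    have hδ0 : δ = 0 := by nlinarith [sq_nonneg A, sq_nonneg δ]
    rw [hA, hδ0] at hδ
    have hB : B = 0 := by linear_combination -hδ
    rw [hA, hB] at hC hD
    have hC0 : C' = 0 := by linear_combination hC
    have hD0 : D = 0 := by linear_combination hD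
    apply h0
    simp [hA, hB, hC0, hD0]
  obtain ⟨k, hk⟩ : ∃ k : ℝ, k ^ 2 = 1 / 3 := ⟨√(1 / 3), Real.sq_sqrt (by norm_num)⟩
  refine ⟨fun _ => 1 / (2 * (A ^ 2 + δ ^ 2)), ![A + k * -δ, A - k * -δ],
    ![B + 2 * a * A + k * (δ * a + A * b), B + 2 * a * A - k * (δ * a + A * b)], ?_⟩
  refine MvPolynomial.funext fun w => ?_
  rw [Fin.sum_univ_two]
  simp only [linearForm, map_add, map_mul, map_pow, eval_C, eval_X, Matrix.cons_val_zero,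
    Matrix.cons_val_one]
  set x := w 0
  set y := w 1
  set l := A * x + (B + 2 * a * A) * y with hl
  set m := -δ * x + (δ * a + A * b) * y with hm
  have hlm : l ^ 2 + m ^ 2 =
      (A ^ 2 + δ ^ 2) * (x ^ 2 - 2 * a * x * y + (a ^ 2 + b ^ 2) * y ^ 2) := by
    have hB : B + 2 * a * A = δ * b - a * A := by linear_combination -hδ
    rw [hl, hm, hB]; ring
  have hcubes : (l + k * m) ^ 3 + (l - k * m) ^ 3 = 2 * (l * (l ^ 2 + m ^ 2)) := by
    linear_combination 6 * l * m ^ 2 * hk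
  have hf' : A * x ^ 3 + B * (x ^ 2 * y) + C' * (x * y ^ 2) + D * y ^ 3 =
      l * (x ^ 2 - 2 * a * x * y + (a ^ 2 + b ^ 2) * y ^ 2) := by
    rw [hl]; linear_combination x * y ^ 2 * hC + y ^ 3 * hD
  have h1 : (A + k * -δ) * x + (B + 2 * a * A + k * (δ * a + A * b)) * y = l + k * m := by
    rw [hl, hm]; ring
  have h2 : (A - k * -δ) * x + (B + 2 * a * A - k * (δ * a + A * b)) * y = l - k * m := by
    rw [hl, hm]; ring
  rw [hf', h1, h2, ← mul_add, hcubes, hlm]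
  field_simp

theorem hess_C_mul_linearForm_sq (e a b : ℝ) : hess (C e * linearForm a b ^ 2) = 0 := by
  have h0 : pderiv 0 (linearForm a b) = C a := by simp [linearForm, pderiv_X]
  have h1 : pderiv 1 (linearForm a b) = C b := by simp [linearForm, pderiv_X]
  simp only [hess, pow_two, pderiv_mul, h0, h1, map_add, pderiv_C, map_zero]
  ring

/-- If `∂ₛ` kills one of the two linear forms, `∂ₛ f` is a multiple of the square of the other, and
its Hessian determinant vanishes. -/
theorem hasDecompositionAvoiding_cubic {f : MvPolynomial (Fin 2) ℝ} (hf : f.IsHomogeneous 3)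
    (h0 : f ≠ 0) (hreal : HasNonrealRoot f) {S : Set (Fin 2 → ℝ)}
    (hS : ∀ s ∈ S, hess (dirDeriv s f) ≠ 0) : HasDecompositionAvoiding 3 f 2 S := by
  obtain ⟨c, α, β, hsum⟩ := exists_eq_sum_two_cubes hf h0 hreal
  refine ⟨c, α, β, hsum, fun s hs i hi => hS s hs ?_⟩
  rw [hsum, dirDeriv_sum, Fin.sum_univ_two, dirDeriv_C_mul_linearForm_pow,
    dirDeriv_C_mul_linearForm_pow]
  fin_cases i
  · simp only [Fin.zero_eta] at hi
    rw [hi, mul_zero, map_zero, zero_mul, zero_add, hess_C_mul_linearForm_sq]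
  · simp only [Fin.mk_one] at hi
    rw [hi, mul_zero, map_zero, zero_mul, add_zero, hess_C_mul_linearForm_sq]

/-! ### The rank of a form with a nonreal root -/

theorem hess_ne_zero_of_hasNonrealRoot {n : ℕ} {f : MvPolynomial (Fin 2) ℝ}
    (hf : f.IsHomogeneous (n + 2)) (hsm : IsSmooth f) (hreal : HasNonrealRoot f) :
    hess f ≠ 0 := by
  obtain ⟨z, -, hzf⟩ := hreal
  intro h
  refine hsm.aeval_hess_ne_zero hf (w := ![z, 1]) (fun h => by simpa using congrFun h 1) hzf ?_
  rw [h, map_zero]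

/-- A smooth form of degree `n + 3` with a nonreal root is a sum of `n + 2` powers. The induction
needs to avoid the linear forms killed by `∂ₛ`, `s ∈ S`. This is not possible for every `S`: in each
decomposition of `xⁿ + yⁿ` into fewer than `n` powers `y` occurs, as `n + 1` distinct powers are
linearly independent, so no such decomposition avoids the form `y` killed by `∂/∂x`. It suffices
that the Hessian determinant of `∂ₛ f` does not vanish, i.e. that `∂ₛ f` is no power of a linear
form. -/
theorem hasDecompositionAvoiding_of_hasNonrealRoot {n : ℕ} :
    ∀ {f : MvPolynomial (Fin 2) ℝ}, f.IsHomogeneous (n + 3) → IsSmooth f → HasNonrealRoot f →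
      ∀ {S : Set (Fin 2 → ℝ)}, S.Finite → (∀ s ∈ S, s ≠ 0) →
        (∀ s ∈ S, hess (dirDeriv s f) ≠ 0) → HasDecompositionAvoiding (n + 3) f (n + 2) S := by
  induction n with
  | zero =>
    intro f hf hsm hreal S _ _ hS
    exact hasDecompositionAvoiding_cubic hf hsm.ne_zero hreal hS
  | succ n ih =>
    intro f hf hsm hreal S hS hS0 hShess
    have hne := hess_ne_zero_of_hasNonrealRoot (n := n + 2) hf hsm hreal
    have hpar : FinitelyManyDirections fun v : Fin 2 → ℝ => ∃ s ∈ S, v 0 * s 1 = v 1 * s 0 :=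
      FinitelyManyDirections.exists_mem hS fun s hs => finitelyManyDirections_parallel (hS0 s hs)
    have hdeg : FinitelyManyDirections fun v : Fin 2 → ℝ =>
        ∃ s ∈ S, hess (dirDeriv v (dirDeriv s f)) = 0 :=
      FinitelyManyDirections.exists_mem hS fun s hs =>
        finitelyManyDirections_hess_dirDeriv_eq_zero
          (isHomogeneous_dirDeriv (n := n + 3) hf s) (hShess s hs)
    obtain ⟨v, hv, hnot, hreal'⟩ := exists_dirDeriv_hasNonrealRoot (n := n + 1) hf hsm hreal
      (((finitelyManyDirections_not_isSmooth (n := n + 2) hf hsm hne).or hpar).or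
        (hdeg.or (finitelyManyDirections_hess_dirDeriv_dirDeriv_eq_zero hf hne)))
      fun v h => Or.inl (Or.inl h)
    push Not at hnot
    obtain ⟨⟨hsm', hvS⟩, hvhess, hvv⟩ := hnot
    refine HasDecompositionAvoiding.of_dirDeriv hf hv hvS
      (ih (isHomogeneous_dirDeriv hf v) hsm' hreal' (hS.insert v) ?_ ?_)
    · rintro s (rfl | hs)
      exacts [hv, hS0 s hs]
    · rintro s (rfl | hs)
      · exact hvv
      · rw [dirDeriv_comm]
        exact hvhess s hs

theorem waringRank_le {n r : ℕ} {f : MvPolynomial (Fin 2) ℝ} (h : HasWaringDecomposition n f r) :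
    waringRank n f ≤ r :=
  iInf₂_le r h

end BinaryForm

theorem corollary2 (n : ℕ) (hn : 3 ≤ n) (f : MvPolynomial (Fin 2) ℝ)
    (hf : f.IsHomogeneous n) (hroots : BinaryForm.NoMultipleComplexRoots f) :
    BinaryForm.waringRank n f = (n : ℕ∞) ↔ (BinaryForm.roots f).encard = (n : ℕ∞) := by
  obtain ⟨m, rfl⟩ := Nat.exists_eq_add_of_le' hn
  have hsm : BinaryForm.IsSmooth f :=
    BinaryForm.NoMultipleComplexRoots.isSmooth (n := m + 1) hf hroots
  constructor
  · intro hrank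
    by_contra hcard
    have hreal : BinaryForm.HasNonrealRoot f := by
      by_contra h
      exact hcard (hsm.encard_roots hf h)
    have hle := BinaryForm.waringRank_le
      (BinaryForm.hasDecompositionAvoiding_of_hasNonrealRoot hf hsm hreal Set.finite_empty
        (by simp) (by simp)).hasWaringDecomposition
    rw [hrank] at hle
    have : m + 3 ≤ m + 2 := by exact_mod_cast hle
    omega
  · intro hcard
    refine le_antisymm ?_ (le_iInf₂ fun r hr => ?_)
    · exact BinaryForm.waringRank_le
        (BinaryForm.hasDecompositionAvoiding_of_real_roots (n := m + 1) hf hsm.ne_zero hcard.ge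
          Set.finite_empty (by simp)).hasWaringDecomposition
    · exact_mod_cast BinaryForm.lt_of_hasWaringDecomposition (n := m + 2) hf hsm.ne_zero
        hcard.ge hr
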